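/- Setting. Let $T>0$, let $(\Omega,\mathcal F,\mathbf P)$ be a probability space, let $H_0,U,V$ be separable real Hilbert spaces, and let $\mathcal L_2(H_0,U)$ be the Hilbert–Schmidt operators $H_0\to U$. Let $W\in C([0,T],\mathcal L(H_0,L^2(\Omega)))$ be a cylindrical Wiener process with reproducing kernel space $H_0$ (for a cylindrical $Q$-Wiener process on a separable Hilbert space $H$, $H_0=Q^{1/2}(H)$): for every $u\in H_0$, $W(\cdot)u$ is a real Brownian motion with respect to the natural filtration of $W$, and $\mathbf E[W(s)u\,W(t)v]=\min(s,t)\langle u,v\rangle_{H_0}$. Let $I(\phi)=\int_0^T\phi\,dW$ for $\phi\in L^2([0,T],H_0)$ be the Wiener integral. For $2\le q\le\infty$ let $\mathcal S^q(U)$ be the set of random variables $X=\sum_{j=1}^m h_j\otimes F_j$ with $h_j\in U$ and $F_j=f_j(I(\phi_{j,1}),\dots,I(\phi_{j,n_j}))$, where $\phi_{j,i}\in L^q([0,T],H_0)$ and $f_j\in C^1(\mathbf R^{n_j},\mathbf R)$ has a derivative of polynomial growth, and set $D_tX=\sum_{j}\sum_i\partial_i f_j(I(\phi_{j,1}),\dots,I(\phi_{j,n_j}))\,h_j\otimes\phi_{j,i}(t)$.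 For $1<p<\infty$ the operator $D\colon\mathcal S^q(U)\subset L^p(\Omega,U)\to L^p(\Omega,L^q([0,T],\mathcal L_2(H_0,U)))$ is closable; its closure is again denoted by $D$, and $\mathbf M^{1,p,q}(U)$ is the domain of the closure, with norm $$\|X\|_{\mathbf M^{1,p,q}(U)}=\Big(\|X\|_{L^p(\Omega,U)}^p+\|DX\|_{L^p(\Omega,L^q([0,T],\mathcal L_2(H_0,U)))}^p\Big)^{1/p}.$$ For $2\le p<\infty$ let $\mathbf G^{1,p}(U)=\mathbf M^{1,p,p}(U)\cap L^{2p}(\Omega,U)$ with norm $\|Y\|_{\mathbf G^{1,p}(U)}=\max(\|Y\|_{\mathbf M^{1,p,p}(U)},\|Y\|_{L^{2p}(\Omega,U)})$, and for $Z\in L^2(\Omega,U)$ let $$\|Z\|_{\mathbf G^{1,p}(U)^*}=\sup_{0\ne Y\in\mathbf G^{1,p}(U)}\frac{\langle Y,Z\rangle_{L^2(\Omega,U)}}{\|Y\|_{\mathbf G^{1,p}(U)}}.$$ Let $\mathcal G_{\mathrm b}^2(U,V)$ be the set of continuous maps $\eta\colon U\to V$ whose first and second Gâteaux derivatives $\eta'(x)\cdot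 u$ and $\eta''(x)\cdot(u_1,u_2)$ exist, are bounded symmetric multilinear forms in the directions, are continuous in $x$ for fixed directions, and for which the seminorms $|\eta|_{\mathcal G_{\mathrm b}^k(U,V)}=\sup_{x\in U}\|\eta^{(k)}(x)\|$, $k=1,2$, are finite, where $\|b\|$ is the smallest $C$ with $\|b\cdot(u_1,\dots,u_k)\|_V\le C\|u_1\|_U\cdots\|u_k\|_U$ for all $u_1,\dots,u_k\in U$. Lemma. Let $\eta\in\mathcal G_{\mathrm b}^2(U,V)$ and $2<p<\infty$. Then, for all $X_1,X_2\in\mathbf M^{1,2p,p}(U)$, the random variables $\eta(X_1),\eta(X_2)$ belong to $L^2(\Omega,V)$ and $$\big\|\eta(X_1)-\eta(X_2)\big\|_{\mathbf G^{1,p}(V)^*}\le\max\big(|\eta|_{\mathcal G_{\mathrm b}^1(U,V)},|\eta|_{\mathcal G_{\mathrm b}^2(U,V)}\big)\Big(1+\sum_{i=1}^2\|X_i\|_{\mathbf M^{1,2p,p}(U)}\Big)\big\|X_1-X_2\big\|_{\mathbf G^{1,p}(U)^*}.$$ -/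

import Mathlib

open MeasureTheory ProbabilityTheory Filter Topology
open scoped ENNReal NNReal RealInnerProductSpace

noncomputable section

namespace SobolevMalliavin

/-! ### Gateaux differentiable maps -/

section Gateaux

variable {U V : Type*} [NormedAddCommGroup U] [NormedSpace ℝ U]
  [NormedAddCommGroup V] [NormedSpace ℝ V]

/-- The recursively defined Gateaux derivatives: `gDeriv φ 0 x = φ x` and
`gDeriv φ (k+1) x (u₁,…,u_{k+1})` is the limit of
`ε⁻¹ (gDeriv φ k (x + ε u_{k+1}) (u₁,…,u_k) - gDeriv φ k x (u₁,…,u_k))` as `ε → 0`.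
Existence of the limits is demanded in `IsG`. -/
def gDeriv (φ : U → V) : (k : ℕ) → U → (Fin k → U) → V
  | 0 => fun x _ => φ x
  | k + 1 => fun x u =>
      lineDeriv ℝ (fun y => gDeriv φ k y (fun i => u i.castSucc)) x (u (Fin.last k))

/-- The class `𝒢^m(U,V)`: continuous maps whose Gateaux derivatives up to order `m` exist, are
bounded symmetric multilinear forms, and are strongly continuous. -/
structure IsG (m : ℕ) (φ : U → V) : Prop where
  continuous : Continuous φ
  exists_limit : ∀ k < m, ∀ (x : U) (u : Fin (k + 1) → U),
    LineDifferentiableAt ℝ (fun y => gDeriv φ k y (fun i => u i.castSucc)) x (u (Fin.last k))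
  multilinear : ∀ k, 1 ≤ k → k ≤ m → ∀ x : U,
    ∃ B : ContinuousMultilinearMap ℝ (fun _ : Fin k => U) V, ∀ u, B u = gDeriv φ k x u
  symmetric : ∀ k, 1 ≤ k → k ≤ m → ∀ (x : U) (u : Fin k → U) (σ : Equiv.Perm (Fin k)),
    gDeriv φ k x (fun i => u (σ i)) = gDeriv φ k x u
  strongly_continuous : ∀ k, 1 ≤ k → k ≤ m → ∀ u : Fin k → U,
    Continuous (fun x => gDeriv φ k x u)

/-- The norm of a `k`-form: the smallest `C` with `‖b(u₁,…,u_k)‖ ≤ C ‖u₁‖ ⋯ ‖u_k‖`. -/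
def formNorm {k : ℕ} (b : (Fin k → U) → V) : ℝ≥0∞ :=
  sInf {C : ℝ≥0∞ | ∀ u : Fin k → U, ‖b u‖ₑ ≤ C * ∏ i, ‖u i‖ₑ}

/-- The seminorm `|φ|_{𝒢_b^m(U,V)} = sup_x ‖φ^{(m)}(x)‖`. -/
def gSeminorm (m : ℕ) (φ : U → V) : ℝ≥0∞ := ⨆ x : U, formNorm (gDeriv φ m x)

/-- The class `𝒢_b^m(U,V)`, for `m ≥ 1`: maps in `𝒢^m(U,V)` with bounded derivatives of
the orders `1,…,m` (the map itself need not be bounded). -/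
def IsGb (m : ℕ) (φ : U → V) : Prop :=
  IsG m φ ∧ ∀ k, 1 ≤ k → k ≤ m → gSeminorm k φ < ∞

end Gateaux

/-! ### Hilbert-Schmidt norm -/

section HilbertSchmidt

variable {H U : Type*} [NormedAddCommGroup H] [InnerProductSpace ℝ H] [CompleteSpace H]
  [NormedAddCommGroup U] [InnerProductSpace ℝ U]

/-- The index set of some fixed orthonormal basis of `H`. -/
def onbSet (H : Type*) [NormedAddCommGroup H] [InnerProductSpace ℝ H] [CompleteSpace H] : Set H :=
  Classical.choose (exists_hilbertBasis ℝ H)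

/-- Some fixed orthonormal basis of `H`. -/
def onb (H : Type*) [NormedAddCommGroup H] [InnerProductSpace ℝ H] [CompleteSpace H] :
    HilbertBasis (onbSet H) ℝ H :=
  Classical.choose (Classical.choose_spec (exists_hilbertBasis ℝ H))

/-- The Hilbert-Schmidt norm `(∑ⱼ ‖S eⱼ‖²)^{1/2}`, with value `∞` if `S` is not a
Hilbert-Schmidt operator. It does not depend on the orthonormal basis. -/
def hsNorm (S : H →L[ℝ] U) : ℝ≥0∞ :=
  (∑' i : onbSet H, ‖S (onb H i)‖ₑ ^ (2 : ℕ)) ^ (1 / 2 : ℝ)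

end HilbertSchmidt

/-! ### Cylindrical Wiener process and Wiener integral -/

section Wiener

variable {Ω : Type*} [MeasurableSpace Ω] (P : Measure Ω)
  {H₀ : Type*} [NormedAddCommGroup H₀] [InnerProductSpace ℝ H₀]

/-- Lebesgue measure on `[0,T]`. -/
def timeMeasure (T : ℝ) : Measure ℝ := volume.restrict (Set.Icc 0 T)

/-- The natural filtration: the `σ`-field generated by `W(r)v`, `0 ≤ r ≤ s`, `v ∈ H₀`. -/
@[reducible] def pastSigma (W : ℝ → H₀ →L[ℝ] Lp ℝ 2 P) (s : ℝ) : MeasurableSpace Ω :=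
  ⨆ r ∈ Set.Icc (0 : ℝ) s, ⨆ v : H₀,
    MeasurableSpace.comap (W r v : Ω → ℝ) inferInstance

/-- `W ∈ C([0,T], L(H₀, L²(Ω)))` is a cylindrical Wiener process with reproducing kernel space
`H₀`: every `W(·)u` is a real Brownian motion with respect to the natural filtration of `W`
(with variance `‖u‖²` at time one), and `E[W(s)u W(t)v] = min(s,t) ⟨u,v⟩`.
Only the values `W t` with `t ∈ [0,T]` matter. -/
structure IsCylindricalWiener (T : ℝ) (W : ℝ → H₀ →L[ℝ] Lp ℝ 2 P) : Prop where
  continuousOn : ContinuousOn W (Set.Icc 0 T)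
  zero : W 0 = 0
  gaussian : ∀ s t : ℝ, 0 ≤ s → s ≤ t → t ≤ T → ∀ u : H₀,
    P.map (W t u - W s u : Lp ℝ 2 P) = gaussianReal 0 (Real.toNNReal ((t - s) * ‖u‖ ^ 2))
  indep : ∀ s t : ℝ, 0 ≤ s → s ≤ t → t ≤ T → ∀ u : H₀,
    Indep (MeasurableSpace.comap ((W t u - W s u : Lp ℝ 2 P) : Ω → ℝ) inferInstance)
      (pastSigma P W s) P
  continuous_version : ∀ u : H₀, ∃ B : ℝ → Ω → ℝ,
    (∀ t ∈ Set.Icc 0 T, B t =ᵐ[P] (W t u : Ω → ℝ)) ∧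
      ∀ ω, ContinuousOn (fun t => B t ω) (Set.Icc 0 T)
  covariance : ∀ s ∈ Set.Icc 0 T, ∀ t ∈ Set.Icc 0 T, ∀ u v : H₀,
    ∫ ω, (W s u : Ω → ℝ) ω * (W t v : Ω → ℝ) ω ∂P = min s t * ⟪u, v⟫

/-- The step function `∑_{i<n} 1_{(tᵢ,tᵢ₊₁]} uᵢ`. -/
def stepFun (n : ℕ) (t : ℕ → ℝ) (u : ℕ → H₀) (r : ℝ) : H₀ :=
  ∑ i ∈ Finset.range n, (Set.Ioc (t i) (t (i + 1))).indicator (fun _ => u i) r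

/-- The integral `∑_{i<n} (W(tᵢ₊₁) - W(tᵢ)) uᵢ` of a step function. -/
def stepIntegral (W : ℝ → H₀ →L[ℝ] Lp ℝ 2 P) (n : ℕ) (t : ℕ → ℝ) (u : ℕ → H₀) : Lp ℝ 2 P :=
  ∑ i ∈ Finset.range n, (W (t (i + 1)) (u i) - W (t i) (u i))

/-- `J = ∫₀ᵀ φ dW` for a deterministic `φ ∈ L²([0,T],H₀)`: `J` is the limit in `L²(Ω)` of the
integrals of step functions that converge to `φ` in `L²([0,T],H₀)`. -/
def IsWienerIntegral (T : ℝ) (W : ℝ → H₀ →L[ℝ] Lp ℝ 2 P) (φ : ℝ → H₀) (J : Lp ℝ 2 P) : Prop :=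
  MemLp φ 2 (timeMeasure T) ∧
  ∃ (n : ℕ → ℕ) (t : ℕ → ℕ → ℝ) (u : ℕ → ℕ → H₀),
    (∀ k, Monotone (t k) ∧ ∀ i, t k i ∈ Set.Icc 0 T) ∧
    Tendsto (fun k => eLpNorm (fun r => stepFun (n k) (t k) (u k) r - φ r) 2 (timeMeasure T))
      atTop (𝓝 0) ∧
    Tendsto (fun k => stepIntegral P W (n k) (t k) (u k)) atTop (𝓝 J)

end Wiener

/-! ### Refined Sobolev-Malliavin spaces -/

section Malliavin

variable {Ω : Type*} [MeasurableSpace Ω] (P : Measure Ω)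
  {H₀ : Type*} [NormedAddCommGroup H₀] [InnerProductSpace ℝ H₀] [CompleteSpace H₀]
  {U : Type*} [NormedAddCommGroup U] [InnerProductSpace ℝ U]

/-- `f ∈ C_p^1(ℝⁿ,ℝ)`: continuously differentiable with derivative of polynomial growth. -/
def IsC1p {n : ℕ} (f : (Fin n → ℝ) → ℝ) : Prop :=
  ContDiff ℝ 1 f ∧ ∃ (C : ℝ) (r : ℕ), ∀ x, ‖fderiv ℝ f x‖ ≤ C * (1 + ‖x‖ ^ r)

/-- `F = f(I(φ₁),…,I(φₙ))` is a real smooth random variable of the class `𝒮^q`, and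
`D_t F = ∑ⱼ ∂ⱼf(I(φ₁),…,I(φₙ)) φⱼ(t)`. -/
def IsSmoothReal (T : ℝ) (W : ℝ → H₀ →L[ℝ] Lp ℝ 2 P) (q : ℝ≥0∞)
    (F : Ω → ℝ) (DF : Ω → ℝ → H₀) : Prop :=
  ∃ (n : ℕ) (f : (Fin n → ℝ) → ℝ) (φ : Fin n → ℝ → H₀) (J : Fin n → Lp ℝ 2 P),
    IsC1p f ∧ (∀ j, MemLp (φ j) q (timeMeasure T)) ∧ (∀ j, IsWienerIntegral P T W (φ j) (J j)) ∧
    (∀ ω, F ω = f (fun j => (J j : Ω → ℝ) ω)) ∧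
    (∀ ω t, DF ω t =
      ∑ j, (fderiv ℝ f (fun i => (J i : Ω → ℝ) ω) (Pi.single j 1)) • φ j t)

/-- `X = ∑ⱼ hⱼ ⊗ Fⱼ` is a `U`-valued smooth random variable of the class `𝒮^q(U)`, and
`D_t X = ∑ⱼ hⱼ ⊗ D_t Fⱼ`, where `h ⊗ g` is the operator `v ↦ ⟨g,v⟩ h` from `H₀` to `U`. -/
def IsSmooth (T : ℝ) (W : ℝ → H₀ →L[ℝ] Lp ℝ 2 P) (q : ℝ≥0∞)
    (X : Ω → U) (DX : Ω → ℝ → H₀ →L[ℝ] U) : Prop :=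
  ∃ (m : ℕ) (h : Fin m → U) (F : Fin m → Ω → ℝ) (DF : Fin m → Ω → ℝ → H₀),
    (∀ j, IsSmoothReal P T W q (F j) (DF j)) ∧
    (∀ ω, X ω = ∑ j, F j ω • h j) ∧
    (∀ ω t, DX ω t = ∑ j, (innerSL ℝ (DF j ω t)).smulRight (h j))

/-- The norm of `L^p(Ω, L^q([0,T], ℒ₂(H₀,U)))`. -/
def mixedNorm (T : ℝ) (p q : ℝ≥0∞) (Z : Ω → ℝ → H₀ →L[ℝ] U) : ℝ≥0∞ :=
  eLpNorm (fun ω => eLpNorm (fun t => hsNorm (Z ω t)) q (timeMeasure T)) p P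

/-- `Z ∈ L^p(Ω, L^q([0,T], ℒ₂(H₀,U)))`. For separable `H₀` and `U`, measurability into
`ℒ₂(H₀,U)` is the same as measurability of `Z h` for every `h ∈ H₀`. -/
def MemMixed (T : ℝ) (p q : ℝ≥0∞) (Z : Ω → ℝ → H₀ →L[ℝ] U) : Prop :=
  (∀ h : H₀, AEStronglyMeasurable (fun x : Ω × ℝ => Z x.1 x.2 h) (P.prod (timeMeasure T))) ∧
    mixedNorm P T p q Z < ∞

/-- The closure of the Malliavin derivative on `𝒮^q(U)`, as an operator from `L^p(Ω,U)` to
`L^p(Ω, L^q([0,T], ℒ₂(H₀,U)))`: the pair `(X, Z)` lies in the closure of the graph. -/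
def HasMalliavinDeriv (T : ℝ) (W : ℝ → H₀ →L[ℝ] Lp ℝ 2 P) (p q : ℝ≥0∞)
    (X : Ω → U) (Z : Ω → ℝ → H₀ →L[ℝ] U) : Prop :=
  MemLp X p P ∧ MemMixed P T p q Z ∧
  ∃ (Y : ℕ → Ω → U) (DY : ℕ → Ω → ℝ → H₀ →L[ℝ] U),
    (∀ n, IsSmooth P T W q (Y n) (DY n)) ∧
    Tendsto (fun n => eLpNorm (fun ω => Y n ω - X ω) p P) atTop (𝓝 0) ∧
    Tendsto (fun n => mixedNorm P T p q (fun ω t => DY n ω t - Z ω t)) atTop (𝓝 0)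

/-- `X ∈ 𝐌^{1,p,q}(U)`. -/
def MemM (T : ℝ) (W : ℝ → H₀ →L[ℝ] Lp ℝ 2 P) (p q : ℝ≥0∞) (X : Ω → U) : Prop :=
  ∃ Z : Ω → ℝ → H₀ →L[ℝ] U, HasMalliavinDeriv P T W p q X Z

/-- The norm `(‖X‖_{L^p(Ω,U)}^p + ‖DX‖_{L^p(Ω,L^q([0,T],ℒ₂(H₀,U)))}^p)^{1/p}` of
`𝐌^{1,p,q}(U)`, for `1 < p < ∞` and `2 ≤ q ≤ ∞`. The derivative `DX` is the almost everywhere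
unique `Z` with `HasMalliavinDeriv P T W p q X Z` (the Malliavin derivative is closable), so that
the infimum runs over one value; it is `∞` if `X` is not in the space. -/
def mNorm (T : ℝ) (W : ℝ → H₀ →L[ℝ] Lp ℝ 2 P) (p q : ℝ≥0∞) (X : Ω → U) : ℝ≥0∞ :=
  ⨅ (Z : Ω → ℝ → H₀ →L[ℝ] U) (_ : HasMalliavinDeriv P T W p q X Z),
    (eLpNorm X p P ^ p.toReal + mixedNorm P T p q Z ^ p.toReal) ^ (1 / p.toReal)

/-- `X ∈ 𝐆^{1,p}(U) = 𝐌^{1,p,p}(U) ∩ L^{2p}(Ω,U)`. -/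
def MemG (T : ℝ) (W : ℝ → H₀ →L[ℝ] Lp ℝ 2 P) (p : ℝ≥0∞) (X : Ω → U) : Prop :=
  MemM P T W p p X ∧ MemLp X (2 * p) P

/-- The norm `max(‖X‖_{𝐌^{1,p,p}(U)}, ‖X‖_{L^{2p}(Ω,U)})` of `𝐆^{1,p}(U)`. -/
def gNorm (T : ℝ) (W : ℝ → H₀ →L[ℝ] Lp ℝ 2 P) (p : ℝ≥0∞) (X : Ω → U) : ℝ≥0∞ :=
  max (mNorm P T W p p X) (eLpNorm X (2 * p) P)

/-- The norm of `X ∈ L²(Ω,U)` in the dual of `𝐆^{1,p}(U)`: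
`sup ⟨Y, X⟩_{L²(Ω,U)} / ‖Y‖_{𝐆^{1,p}(U)}` over all `Y ∈ 𝐆^{1,p}(U)` (the quotient is `0` for
`Y = 0`, as `0 / 0 = 0`). -/
def gDualNorm (T : ℝ) (W : ℝ → H₀ →L[ℝ] Lp ℝ 2 P) (p : ℝ≥0∞) (X : Ω → U) : ℝ≥0∞ :=
  ⨆ (Y : Ω → U) (_ : MemG P T W p Y),
    ENNReal.ofReal (∫ ω, ⟪Y ω, X ω⟫ ∂P) / gNorm P T W p Y

end Malliavin

end SobolevMalliavin

end

/-!
The estimate is dual to a boundedness statement. With `K = X₁ - X₂` and `X_ρ = X₂ + ρK`, the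
function `ρ ↦ E⟨Y, η(X_ρ)⟩` has the derivative `E⟨Y, η'(X_ρ)K⟩ = E⟨η'(X_ρ)* Y, K⟩`, which is at
most `‖η'(X_ρ)* Y‖_G ‖K‖_{G*}`; the mean value theorem on `[0,1]` gives the assertion once the map
`Y ↦ η'(X_ρ)* Y` is known to be bounded from `𝐆^{1,p}(V)` to `𝐆^{1,p}(U)`, uniformly in `ρ`
(`MemG.adjoint_apply_convexComb`). This follows from the product rule
`D(η'(X)* Y) = (η''(X)(·, DX))* Y + η'(X)* DY`, with Hölder's inequality in `ω` for the first
summand: this is where `X ∈ 𝐌^{1,2p,p}` and `Y ∈ L^{2p}` are needed.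

The point that needs care is the product rule (`HasMalliavinDeriv.adjoint_apply`). Since `η''` is
only strongly continuous, `x ↦ η''(x)(·, u)* y` is only weakly continuous, and the map
`(x, y) ↦ η'(x)* y` is not covered by a chain rule for strongly continuous Gateaux derivatives.
Its coordinates `⟨η'(x)e, y⟩` are, once `y` is replaced by the bounded smooth map
`y / (1 + s‖y‖²)` of `y`. So the scalar chain rule `HasMalliavinDeriv.comp` is applied to finitely
many coordinates, and the resulting random variables `P_F η'(X)* (Y / (1 + s‖Y‖²))` and their
derivatives converge, by dominated convergence, as `s → 0` and the finite-rank projections `P_F`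
increase to the identity. The graph of the Malliavin derivative is closed by definition, which
gives the product rule.

The scalar chain rule rests on the fact that a Gateaux differentiable map with strongly continuous
derivative is of class `C¹` on finite-dimensional subspaces, so that it maps smooth random
variables to smooth random variables (`IsSmooth.comp`).

The norm of `𝐌^{1,p,q}` is an infimum over all derivatives of a random variable. All bounds are
established for an arbitrary choice of the derivatives, so that uniqueness of the Malliavin
derivative plays no role.
-/

open MeasureTheory ProbabilityTheory Filter Topology
open scoped ENNReal NNReal RealInnerProductSpace

namespace SobolevMalliavin

/-! ### Hilbert-Schmidt norms -/

section HilbertSchmidt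

variable {H U V : Type*} [NormedAddCommGroup H] [InnerProductSpace ℝ H] [CompleteSpace H]
  [NormedAddCommGroup U] [InnerProductSpace ℝ U] [NormedAddCommGroup V] [InnerProductSpace ℝ V]

theorem countable_onbSet [TopologicalSpace.SeparableSpace H] : Countable (onbSet H) := by
  have hd : Pairwise (Function.onFun Disjoint
      (fun i : onbSet H => Metric.ball (onb H i) (1 / 2))) := by
    intro i j hij
    have ho := (onb H).orthonormal
    have h2 : ‖onb H i - onb H j‖ ^ 2 = 2 := by
      rw [norm_sub_sq_real, ho.1 i, ho.1 j, ho.2 hij]; norm_num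
    refine Metric.ball_disjoint_ball ?_
    rw [dist_eq_norm]
    nlinarith [norm_nonneg (onb H i - onb H j)]
  refine Pairwise.countable_of_isOpen_disjoint hd (fun i => Metric.isOpen_ball) fun i => ?_
  exact ⟨onb H i, Metric.mem_ball_self (by norm_num)⟩

theorem hsNorm_eq_lintegral (S : H →L[ℝ] U) :
    hsNorm S = (@lintegral (onbSet H) ⊤ (@Measure.count _ ⊤)
      (fun i => ‖S (onb H i)‖ₑ ^ (2 : ℝ))) ^ (1 / 2 : ℝ) := by
  let _ : MeasurableSpace (onbSet H) := ⊤
  rw [lintegral_count' measurable_from_top, hsNorm]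
  simp

theorem hsNorm_le_mul {S : H →L[ℝ] U} {R : H →L[ℝ] V} {c : ℝ≥0∞}
    (h : ∀ v, ‖S v‖ₑ ≤ c * ‖R v‖ₑ) : hsNorm S ≤ c * hsNorm R := by
  have hc : c = (c ^ 2) ^ (1 / 2 : ℝ) := by
    rw [← ENNReal.rpow_natCast, ← ENNReal.rpow_mul]; simp
  rw [hsNorm, hsNorm]
  nth_rewrite 1 [hc]
  rw [← ENNReal.mul_rpow_of_nonneg _ _ (by norm_num), ← ENNReal.tsum_mul_left]
  refine ENNReal.rpow_le_rpow (ENNReal.tsum_le_tsum fun i => ?_) (by norm_num)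
  rw [← mul_pow]
  exact pow_le_pow_left' (h _) 2

theorem hsNorm_comp_le (A : U →L[ℝ] V) (S : H →L[ℝ] U) : hsNorm (A ∘L S) ≤ ‖A‖ₑ * hsNorm S :=
  hsNorm_le_mul fun v => A.le_opENorm (S v)

theorem hsNorm_neg (S : H →L[ℝ] U) : hsNorm (-S) = hsNorm S := by
  simp [hsNorm]

theorem hsNorm_add_le (S R : H →L[ℝ] U) : hsNorm (S + R) ≤ hsNorm S + hsNorm R := by
  let _ : MeasurableSpace (onbSet H) := ⊤
  simp only [hsNorm_eq_lintegral]
  refine le_trans ?_ (ENNReal.lintegral_Lp_add_le measurable_from_top.aemeasurable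
    measurable_from_top.aemeasurable (by norm_num))
  refine ENNReal.rpow_le_rpow (lintegral_mono fun i => ?_) (by norm_num)
  exact ENNReal.rpow_le_rpow (enorm_add_le _ _) (by norm_num)

theorem hsNorm_sub_le (S R : H →L[ℝ] U) : hsNorm (S - R) ≤ hsNorm S + hsNorm R := by
  rw [sub_eq_add_neg, ← hsNorm_neg R]
  exact hsNorm_add_le _ _

/-- Dominated convergence in the Hilbert-Schmidt norm: strong convergence and a pointwise bound by a
Hilbert-Schmidt operator suffice. -/
theorem tendsto_hsNorm_zero {S : ℕ → H →L[ℝ] U} {R : H →L[ℝ] V} {c : ℝ≥0∞} (hc : c ≠ ∞)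
    (hR : hsNorm R ≠ ∞) (hle : ∀ n v, ‖S n v‖ₑ ≤ c * ‖R v‖ₑ)
    (hlim : ∀ v, Tendsto (fun n => S n v) atTop (𝓝 0)) :
    Tendsto (fun n => hsNorm (S n)) atTop (𝓝 0) := by
  let _ : MeasurableSpace (onbSet H) := ⊤
  have hR' : ∫⁻ i : onbSet H, ‖R (onb H i)‖ₑ ^ (2 : ℝ) ∂Measure.count ≠ ∞ := by
    intro h
    rw [hsNorm_eq_lintegral, h] at hR
    exact hR (by norm_num)
  have h0 : Tendsto (fun n => ∫⁻ i : onbSet H, ‖S n (onb H i)‖ₑ ^ (2 : ℝ) ∂Measure.count) atTop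
      (𝓝 (∫⁻ i : onbSet H, 0 ∂Measure.count)) := by
    refine tendsto_lintegral_of_dominated_convergence
      (fun i => (c * ‖R (onb H i)‖ₑ) ^ (2 : ℝ)) (fun n => measurable_from_top)
      (fun n => ae_of_all _ fun i => ENNReal.rpow_le_rpow (hle n _) (by norm_num)) ?_
      (ae_of_all _ fun i => ?_)
    · simp_rw [ENNReal.mul_rpow_of_nonneg _ _ (show (0 : ℝ) ≤ 2 by norm_num)]
      rw [lintegral_const_mul _ measurable_from_top]
      exact ENNReal.mul_ne_top (ENNReal.rpow_ne_top_of_nonneg (by norm_num) hc) hR'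
    · have := ((hlim (onb H i)).enorm).ennrpow_const 2
      simpa using this
  simp only [hsNorm_eq_lintegral]
  simpa using h0.ennrpow_const (1 / 2)

end HilbertSchmidt

/-! ### The norm of `L^p(Ω, L^q([0,T], ℒ₂(H₀,U)))` -/

section MixedNorm

variable {α : Type*} [MeasurableSpace α] {μ : Measure α}

/-- Dominated convergence for `eLpNorm`, with limit zero. -/
theorem tendsto_eLpNorm_zero {p : ℝ≥0∞} (hp0 : p ≠ 0) (hp : p ≠ ∞) {f : ℕ → α → ℝ≥0∞}
    {g : α → ℝ≥0∞} (hf : ∀ n, AEMeasurable (f n) μ) (hle : ∀ n, ∀ᵐ x ∂μ, f n x ≤ g x)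
    (hg : eLpNorm g p μ ≠ ∞) (hlim : ∀ᵐ x ∂μ, Tendsto (fun n => f n x) atTop (𝓝 0)) :
    Tendsto (fun n => eLpNorm (f n) p μ) atTop (𝓝 0) := by
  have hpp : 0 < p.toReal := ENNReal.toReal_pos hp0 hp
  simp only [eLpNorm_eq_lintegral_rpow_enorm_toReal hp0 hp, enorm_eq_self] at hg ⊢
  have hg' : ∫⁻ x, g x ^ p.toReal ∂μ ≠ ∞ := by
    intro h
    rw [h] at hg
    exact hg (ENNReal.top_rpow_of_pos (by positivity))
  have h0 : Tendsto (fun n => ∫⁻ x, f n x ^ p.toReal ∂μ) atTop (𝓝 (∫⁻ _, 0 ∂μ)) := by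
    refine tendsto_lintegral_of_dominated_convergence' (fun x => g x ^ p.toReal)
      (fun n => (hf n).pow_const _) (fun n => ?_) hg' ?_
    · filter_upwards [hle n] with x hx using ENNReal.rpow_le_rpow hx hpp.le
    · filter_upwards [hlim] with x hx
      simpa [ENNReal.zero_rpow_of_pos hpp] using hx.ennrpow_const p.toReal
  have h1 := h0.ennrpow_const (1 / p.toReal)
  simpa [ENNReal.zero_rpow_of_pos (inv_pos.2 hpp)] using h1

variable {H U V : Type*} [NormedAddCommGroup H] [InnerProductSpace ℝ H] [CompleteSpace H]
  [TopologicalSpace.SeparableSpace H]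
  [NormedAddCommGroup U] [InnerProductSpace ℝ U] [NormedAddCommGroup V] [InnerProductSpace ℝ V]

theorem aemeasurable_hsNorm {Z : α → H →L[ℝ] U}
    (hZ : ∀ h, AEStronglyMeasurable (fun x => Z x h) μ) :
    AEMeasurable (fun x => hsNorm (Z x)) μ := by
  have := countable_onbSet (H := H)
  unfold hsNorm
  refine AEMeasurable.pow_const ?_ _
  exact AEMeasurable.tsum fun i => (hZ _).enorm.pow_const 2

variable {Ω : Type*} [MeasurableSpace Ω] {P : Measure Ω} {T : ℝ} {p q : ℝ≥0∞}

instance : IsFiniteMeasure (timeMeasure T) := by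
  unfold timeMeasure; infer_instance

/-- Strong measurability of an operator-valued process: all `(ω, t) ↦ Z ω t h` are measurable. -/
abbrev OpMeasurable (P : Measure Ω) (T : ℝ) (Z : Ω → ℝ → H →L[ℝ] U) : Prop :=
  ∀ h, AEStronglyMeasurable (fun x : Ω × ℝ => Z x.1 x.2 h) (P.prod (timeMeasure T))

/-- For equal exponents, Tonelli's theorem identifies the iterated norm with the norm on
`Ω × [0,T]`. -/
theorem mixedNorm_eq_eLpNorm_prod (hp0 : p ≠ 0) (hp : p ≠ ∞) {Z : Ω → ℝ → H →L[ℝ] U}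
    (hZ : OpMeasurable P T Z) :
    mixedNorm P T p p Z =
      eLpNorm (fun x : Ω × ℝ => hsNorm (Z x.1 x.2)) p (P.prod (timeMeasure T)) := by
  have hpp : 0 < p.toReal := ENNReal.toReal_pos hp0 hp
  simp only [mixedNorm, eLpNorm_eq_lintegral_rpow_enorm_toReal hp0 hp, enorm_eq_self]
  rw [lintegral_prod _ ((aemeasurable_hsNorm hZ).pow_const _)]
  simp only [← ENNReal.rpow_mul, one_div, inv_mul_cancel₀ hpp.ne', ENNReal.rpow_one]

theorem aemeasurable_inner_eLpNorm (hp0 : p ≠ 0) (hp : p ≠ ∞) {Z : Ω → ℝ → H →L[ℝ] U}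
    (hZ : OpMeasurable P T Z) :
    AEMeasurable (fun ω => eLpNorm (fun t => hsNorm (Z ω t)) p (timeMeasure T)) P := by
  simp only [eLpNorm_eq_lintegral_rpow_enorm_toReal hp0 hp, enorm_eq_self]
  exact (((aemeasurable_hsNorm hZ).pow_const _).lintegral_prod_right').pow_const _

theorem mixedNorm_add_le (hp1 : 1 ≤ p) (hp : p ≠ ∞) {Z R : Ω → ℝ → H →L[ℝ] U}
    (hZ : OpMeasurable P T Z)
    (hR : OpMeasurable P T R) :
    mixedNorm P T p p (fun ω t => Z ω t + R ω t) ≤ mixedNorm P T p p Z + mixedNorm P T p p R := by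
  have hp0 : p ≠ 0 := (one_pos.trans_le hp1).ne'
  rw [mixedNorm_eq_eLpNorm_prod hp0 hp hZ, mixedNorm_eq_eLpNorm_prod hp0 hp hR,
    mixedNorm_eq_eLpNorm_prod hp0 hp (fun h => (hZ h).add (hR h))]
  refine le_trans (eLpNorm_mono_enorm fun x => ?_) (eLpNorm_add_le
    (aemeasurable_hsNorm hZ).aestronglyMeasurable (aemeasurable_hsNorm hR).aestronglyMeasurable hp1)
  simpa using hsNorm_add_le _ _

omit [TopologicalSpace.SeparableSpace H] in
theorem mixedNorm_le_mul {c : ℝ≥0} {Z : Ω → ℝ → H →L[ℝ] U}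
    {R : Ω → ℝ → H →L[ℝ] V} (h : ∀ ω t v, ‖Z ω t v‖ₑ ≤ c * ‖R ω t v‖ₑ) :
    mixedNorm P T p q Z ≤ c * mixedNorm P T p q R := by
  rw [mixedNorm, mixedNorm]
  refine eLpNorm_le_nnreal_smul_eLpNorm_of_ae_le_mul' (ae_of_all _ fun ω => ?_) p
  simp only [enorm_eq_self]
  refine eLpNorm_le_nnreal_smul_eLpNorm_of_ae_le_mul' (ae_of_all _ fun t => ?_) q
  simp only [enorm_eq_self]
  exact hsNorm_le_mul (h ω t)

theorem mixedNorm_mono_exponent [IsProbabilityMeasure P] {p' : ℝ≥0∞} (hpp : p ≤ p')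
    (hq0 : q ≠ 0) (hq : q ≠ ∞)
    {Z : Ω → ℝ → H →L[ℝ] U}
    (hZ : OpMeasurable P T Z) :
    mixedNorm P T p q Z ≤ mixedNorm P T p' q Z :=
  eLpNorm_le_eLpNorm_of_exponent_le hpp
    (aemeasurable_inner_eLpNorm hq0 hq hZ).aestronglyMeasurable

end MixedNorm

/-! ### Bounded Gateaux derivatives -/

section GateauxDeriv

variable {E F G : Type*} [NormedAddCommGroup E] [NormedSpace ℝ E]
  [NormedAddCommGroup F] [NormedSpace ℝ F] [NormedAddCommGroup G] [NormedSpace ℝ G]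

/-- `g'` is the Gateaux derivative of `g`; it is strongly continuous and bounded by `C` in the
operator norm. (Continuity of `g'` in the operator norm is not demanded.) -/
structure HasBddGateauxDeriv (g : E → F) (g' : E → E →L[ℝ] F) (C : ℝ≥0) : Prop where
  hasLineDerivAt : ∀ x v, HasLineDerivAt ℝ g (g' x v) x v
  continuous_apply : ∀ v, Continuous fun x => g' x v
  norm_le : ∀ x, ‖g' x‖ ≤ C

theorem hasDerivAt_line {g : E → F} {x v : E} {t : ℝ} {f' : F}
    (h : HasLineDerivAt ℝ g f' (x + t • v) v) : HasDerivAt (fun s : ℝ => g (x + s • v)) f' t := by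
  have h1 : HasDerivAt (fun s : ℝ => g (x + t • v + s • v)) f' (t - t) := by
    rw [sub_self]; exact h
  have h2 := HasDerivAt.comp_sub_const (a := t) (x := t) h1
  refine h2.congr_of_eventuallyEq (Eventually.of_forall fun s => ?_)
  simp only
  congr 1
  module

/-- A strongly continuous and bounded family of operators is jointly continuous. -/
theorem continuous_clm_apply_of_bdd {X : Type*} [TopologicalSpace X] {A : X → E →L[ℝ] F} {C : ℝ≥0}
    (hA : ∀ v, Continuous fun x => A x v) (hC : ∀ x, ‖A x‖ ≤ C) :
    Continuous fun z : X × E => A z.1 z.2 := by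
  refine continuous_prod_of_continuous_lipschitzWith' _ C (fun x => ?_) hA
  exact LipschitzWith.weaken (A x).lipschitz (hC x)

namespace HasBddGateauxDeriv

variable {g : E → F} {g' : E → E →L[ℝ] F} {C : ℝ≥0}

theorem lipschitzWith (hg : HasBddGateauxDeriv g g' C) : LipschitzWith C g := by
  refine LipschitzWith.of_dist_le_mul fun y x => ?_
  rw [dist_eq_norm, dist_eq_norm]
  have := norm_image_sub_le_of_norm_deriv_le_segment_01' (f := fun s : ℝ => g (x + s • (y - x)))
    (f' := fun s => g' (x + s • (y - x)) (y - x)) (C := C * ‖y - x‖)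
    (fun s _ => (hasDerivAt_line (hg.hasLineDerivAt _ _)).hasDerivWithinAt)
    (fun s _ => (g' _).le_of_opNorm_le (hg.norm_le _) _)
  simpa using this

theorem continuous (hg : HasBddGateauxDeriv g g' C) : Continuous g := hg.lipschitzWith.continuous

theorem continuous_uncurry (hg : HasBddGateauxDeriv g g' C) :
    Continuous fun z : E × E => g' z.1 z.2 :=
  continuous_clm_apply_of_bdd hg.continuous_apply hg.norm_le

theorem comp_clm (hg : HasBddGateauxDeriv g g' C) (L : G →L[ℝ] E) :
    HasBddGateauxDeriv (fun x => g (L x)) (fun x => (g' (L x)).comp L) (C * ‖L‖₊) where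
  hasLineDerivAt x v := by
    have := hg.hasLineDerivAt (L x) (L v)
    simpa [HasLineDerivAt] using this
  continuous_apply v := (hg.continuous_apply (L v)).comp L.continuous
  norm_le x := by
    refine ((g' (L x)).opNorm_comp_le L).trans ?_
    push_cast
    gcongr
    · exact hg.norm_le _

variable [FiniteDimensional ℝ E]

theorem continuous_of_finiteDimensional (hg : HasBddGateauxDeriv g g' C) : Continuous g' :=
  continuous_clm_apply.2 hg.continuous_apply

/-- In finite dimensions, `g'` is continuous in the operator norm and hence a Fréchet derivative. -/
theorem hasFDerivAt (hg : HasBddGateauxDeriv g g' C) (x : E) : HasFDerivAt g (g' x) x := by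
  rw [hasFDerivAt_iff_isLittleO, Asymptotics.isLittleO_iff]
  intro ε hε
  obtain ⟨δ, hδ, hball⟩ := Metric.continuous_iff.1 hg.continuous_of_finiteDimensional x ε hε
  filter_upwards [Metric.ball_mem_nhds x hδ] with y hy
  have := norm_image_sub_le_of_norm_deriv_le_segment_01'
    (f := fun s : ℝ => g (x + s • (y - x)) - s • g' x (y - x))
    (f' := fun s => g' (x + s • (y - x)) (y - x) - g' x (y - x)) (C := ε * ‖y - x‖)
    (fun s _ => ?_) (fun s hs => ?_)
  · simpa [sub_right_comm] using this
  · refine ((hasDerivAt_line (hg.hasLineDerivAt _ _)).sub ?_).hasDerivWithinAt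
    simpa using (hasDerivAt_id s).smul_const (g' x (y - x))
  · rw [← sub_apply]
    refine ContinuousLinearMap.le_of_opNorm_le _ ?_ _
    rw [← dist_eq_norm]
    refine (hball _ ?_).le
    rw [dist_eq_norm, add_sub_cancel_left, norm_smul, Real.norm_eq_abs, abs_of_nonneg hs.1]
    rw [Metric.mem_ball, dist_eq_norm] at hy
    exact (mul_le_of_le_one_left (norm_nonneg _) hs.2.le).trans_lt hy

theorem fderiv_eq (hg : HasBddGateauxDeriv g g' C) : fderiv ℝ g = g' :=
  funext fun x => (hg.hasFDerivAt x).fderiv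

theorem contDiff (hg : HasBddGateauxDeriv g g' C) : ContDiff ℝ 1 g := by
  rw [contDiff_one_iff_fderiv, hg.fderiv_eq]
  exact ⟨fun x => (hg.hasFDerivAt x).differentiableAt, hg.continuous_of_finiteDimensional⟩

end HasBddGateauxDeriv

end GateauxDeriv

/-! ### Functions of polynomial growth -/

section PolynomialGrowth

/-- `u` grows at most polynomially. -/
def PolyGrowth {E : Type*} [Norm E] (u : E → ℝ) : Prop :=
  ∃ (C : ℝ) (r : ℕ), ∀ x, u x ≤ C * (1 + ‖x‖ ^ r)

variable {E : Type*} [NormedAddCommGroup E]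

theorem PolyGrowth.add {u v : E → ℝ} (hu : PolyGrowth u) (hv : PolyGrowth v) :
    PolyGrowth fun x => u x + v x := by
  obtain ⟨C, r, h⟩ := hu
  obtain ⟨D, s, k⟩ := hv
  have aux : ∀ (a : ℝ) (m n : ℕ), 0 ≤ a → 1 + a ^ m ≤ 2 * (1 + a ^ (m + n)) := fun a m n ha => by
    rcases le_total a 1 with h1 | h1
    · have := pow_le_one₀ ha h1 (n := m)
      have : 0 ≤ a ^ (m + n) := by positivity
      linarith
    · have := pow_le_pow_right₀ h1 (Nat.le_add_right m n)
      have : 0 ≤ a ^ (m + n) := by positivity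
      linarith
  refine ⟨2 * |C| + 2 * |D|, r + s, fun x => ?_⟩
  have h1 := aux ‖x‖ r s (norm_nonneg _)
  have h2 := aux ‖x‖ s r (norm_nonneg _)
  rw [add_comm s r] at h2
  calc u x + v x ≤ |C| * (1 + ‖x‖ ^ r) + |D| * (1 + ‖x‖ ^ s) := by
        refine add_le_add ((h x).trans ?_) ((k x).trans ?_)
        · gcongr; exact le_abs_self C
        · gcongr; exact le_abs_self D
    _ ≤ |C| * (2 * (1 + ‖x‖ ^ (r + s))) + |D| * (2 * (1 + ‖x‖ ^ (r + s))) := by gcongr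
    _ = _ := by ring

theorem PolyGrowth.sum {ι : Type*} (s : Finset ι) {u : ι → E → ℝ} (hu : ∀ i, PolyGrowth (u i)) :
    PolyGrowth fun x => ∑ i ∈ s, u i x := by
  classical
  induction s using Finset.induction_on with
  | empty => exact ⟨0, 0, by simp⟩
  | insert a s ha ih => simpa [Finset.sum_insert ha] using (hu a).add ih

theorem PolyGrowth.mono {u v : E → ℝ} (hv : PolyGrowth v) (h : ∀ x, u x ≤ v x) : PolyGrowth u := by
  obtain ⟨C, r, k⟩ := hv
  exact ⟨C, r, fun x => (h x).trans (k x)⟩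

theorem PolyGrowth.const_mul {u : E → ℝ} (hu : PolyGrowth u) {c : ℝ} (hc : 0 ≤ c) :
    PolyGrowth fun x => c * u x := by
  obtain ⟨C, r, h⟩ := hu
  exact ⟨c * C, r, fun x => by rw [mul_assoc]; exact mul_le_mul_of_nonneg_left (h x) hc⟩

theorem PolyGrowth.comp {F : Type*} [NormedAddCommGroup F] {u : E → ℝ} (hu : PolyGrowth u)
    {L : F → E} (hL : ∀ x, ‖L x‖ ≤ ‖x‖) : PolyGrowth fun x => u (L x) := by
  obtain ⟨C, r, h⟩ := hu
  refine ⟨|C|, r, fun x => (h _).trans ?_⟩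
  calc C * (1 + ‖L x‖ ^ r) ≤ |C| * (1 + ‖L x‖ ^ r) := by gcongr; exact le_abs_self C
    _ ≤ _ := by gcongr; exact hL x

end PolynomialGrowth

/-! ### Smooth random variables -/

section Smooth

variable {Ω : Type*} [MeasurableSpace Ω] {P : Measure Ω}
  {H₀ : Type*} [NormedAddCommGroup H₀] [InnerProductSpace ℝ H₀]
  {U V : Type*} [NormedAddCommGroup U] [InnerProductSpace ℝ U]
  [NormedAddCommGroup V] [InnerProductSpace ℝ V]
  {T : ℝ} {W : ℝ → H₀ →L[ℝ] Lp ℝ 2 P} {q : ℝ≥0∞}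

/-- Pairing `∑ⱼ ∂ⱼf • wⱼ` with `v` gives the derivative of `f` in the direction `(⟪wⱼ, v⟫)ⱼ`. -/
theorem inner_sum_fderiv_single {n : ℕ} (L : (Fin n → ℝ) →L[ℝ] ℝ) (w : Fin n → H₀) (v : H₀) :
    ⟪∑ j, L (Pi.single j 1) • w j, v⟫ = L fun j => ⟪w j, v⟫ := by
  rw [sum_inner]
  conv_rhs => rw [← LinearMap.sum_single_apply (fun _ : Fin n => ℝ) (fun j => ⟪w j, v⟫)]
  rw [map_sum]
  refine Finset.sum_congr rfl fun j _ => ?_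
  rw [real_inner_smul_left, mul_comm, ← smul_eq_mul, ← map_smul]
  congr 1
  ext i
  by_cases h : i = j
  · subst h; simp
  · simp [h]

theorem IsSmooth.aestronglyMeasurable {X : Ω → U} {DX : Ω → ℝ → H₀ →L[ℝ] U}
    (hX : IsSmooth P T W q X DX) : AEStronglyMeasurable X P := by
  obtain ⟨m, h, F, DF, hF, hXe, -⟩ := hX
  rw [funext hXe]
  refine Finset.aestronglyMeasurable_fun_sum _ fun j _ => AEStronglyMeasurable.smul_const ?_ _
  obtain ⟨n, f, φ, J, hf, -, -, hFe, -⟩ := hF j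
  rw [funext hFe]
  refine hf.1.continuous.comp_aestronglyMeasurable ?_
  exact (aemeasurable_pi_lambda _ fun i =>
    (Lp.aestronglyMeasurable (J i)).aemeasurable).aestronglyMeasurable

theorem IsSmooth.opMeasurable [SFinite P] {X : Ω → U} {DX : Ω → ℝ → H₀ →L[ℝ] U}
    (hX : IsSmooth P T W q X DX) : OpMeasurable P T DX := by
  intro v
  obtain ⟨m, h, F, DF, hF, -, hDX⟩ := hX
  have : (fun x : Ω × ℝ => DX x.1 x.2 v) = fun x => ∑ j, ⟪DF j x.1 x.2, v⟫ • h j := by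
    ext1 x; simp [hDX]
  rw [this]
  refine Finset.aestronglyMeasurable_fun_sum _ fun j _ => AEStronglyMeasurable.smul_const ?_ _
  obtain ⟨n, f, φ, J, hf, hφ, -, -, hDF⟩ := hF j
  have : (fun x : Ω × ℝ => ⟪DF j x.1 x.2, v⟫) =
      fun x => ∑ i, fderiv ℝ f (fun i => (J i : Ω → ℝ) x.1) (Pi.single i 1) * ⟪φ i x.2, v⟫ := by
    ext1 x; simp [hDF, sum_inner, real_inner_smul_left]
  rw [this]
  refine Finset.aestronglyMeasurable_fun_sum _ fun i _ => AEStronglyMeasurable.mul ?_ ?_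
  · refine AEStronglyMeasurable.comp_fst
      (f := fun ω => fderiv ℝ f (fun i => (J i : Ω → ℝ) ω) (Pi.single i 1)) ?_
    refine Continuous.comp_aestronglyMeasurable (g := fun x => fderiv ℝ f x (Pi.single i 1))
      ((hf.1.continuous_fderiv (by norm_num)).clm_apply continuous_const) ?_
    exact (aemeasurable_pi_lambda _ fun i =>
      (Lp.aestronglyMeasurable (J i)).aemeasurable).aestronglyMeasurable
  · exact ((hφ i).1.inner aestronglyMeasurable_const).comp_snd (f := fun t => ⟪φ i t, v⟫)

theorem IsSmooth.clm {X : Ω → U} {DX : Ω → ℝ → H₀ →L[ℝ] U}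
    (hX : IsSmooth P T W q X DX) (A : U →L[ℝ] V) :
    IsSmooth P T W q (fun ω => A (X ω)) (fun ω t => A ∘L DX ω t) := by
  obtain ⟨m, h, F, DF, hF, hXe, hDX⟩ := hX
  refine ⟨m, fun j => A (h j), F, DF, hF, fun ω => ?_, fun ω t => ?_⟩
  · simp [hXe]
  · ext v; simp [hDX]

theorem IsSmooth.add {X Y : Ω → U} {DX DY : Ω → ℝ → H₀ →L[ℝ] U}
    (hX : IsSmooth P T W q X DX) (hY : IsSmooth P T W q Y DY) :
    IsSmooth P T W q (fun ω => X ω + Y ω) (fun ω t => DX ω t + DY ω t) := by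
  obtain ⟨m, h, F, DF, hF, hXe, hDX⟩ := hX
  obtain ⟨n, k, G, DG, hG, hYe, hDY⟩ := hY
  refine ⟨m + n, Fin.append h k, Fin.append F G, Fin.append DF DG, fun j => ?_, fun ω => ?_,
    fun ω t => ?_⟩
  · refine Fin.addCases (fun i => ?_) (fun i => ?_) j
    · simpa using hF i
    · simpa using hG i
  · simp [hXe, hYe, Fin.sum_univ_add]
  · simp [hDX, hDY, Fin.sum_univ_add]

/-- The chain rule for smooth random variables. On the span of the finitely many vectors `hⱼ`, a
Gateaux differentiable map with strongly continuous derivative is of class `C¹`. -/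
theorem IsSmooth.comp {X : Ω → U} {DX : Ω → ℝ → H₀ →L[ℝ] U} (hX : IsSmooth P T W q X DX)
    {g : U → ℝ} {g' : U → U →L[ℝ] ℝ} {C : ℝ≥0} (hg : HasBddGateauxDeriv g g' C) :
    IsSmooth P T W q (fun ω => g (X ω)) (fun ω t => g' (X ω) ∘L DX ω t) := by
  obtain ⟨m, h, F, DF, hF, hXe, hDX⟩ := hX
  choose n f φ J hf hφ hJ hFe hDF using hF
  -- all Wiener integrals that occur in the `F j` are collected into one finite family, indexed
  -- through `e`; `π j` extracts the arguments of `f j`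
  let e : (Σ j, Fin (n j)) ≃ Fin (∑ j, n j) := finSigmaFinEquiv
  let π : ∀ j, (Fin (∑ j, n j) → ℝ) →L[ℝ] (Fin (n j) → ℝ) := fun j =>
    ContinuousLinearMap.pi fun i => ContinuousLinearMap.proj (e ⟨j, i⟩)
  have hπ : ∀ j x, ‖π j x‖ ≤ ‖x‖ := fun j x =>
    (pi_norm_le_iff_of_nonneg (norm_nonneg _)).2 fun i => norm_le_pi_norm x _
  let L : (Fin m → ℝ) →L[ℝ] U := ∑ j, (ContinuousLinearMap.proj j).smulRight (h j)
  have hL : ∀ c, L c = ∑ j, c j • h j := fun c => by simp [L]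
  have hk := hg.comp_clm L
  let F' : (Fin (∑ j, n j) → ℝ) → Fin m → ℝ := fun x j => f j (π j x)
  have hF' : ContDiff ℝ 1 F' := contDiff_pi.2 fun j => (hf j).1.comp (π j).contDiff
  have hdF' : ∀ x, HasFDerivAt F'
      (ContinuousLinearMap.pi fun j => (fderiv ℝ (f j) (π j x)).comp (π j)) x := fun x =>
    hasFDerivAt_pi.2 fun j =>
      (((hf j).1.differentiable (by norm_num)) _).hasFDerivAt.comp x (π j).hasFDerivAt
  have hd : ∀ x, fderiv ℝ (fun x => g (L (F' x))) x = ((g' (L (F' x))).comp L).comp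
      (ContinuousLinearMap.pi fun j => (fderiv ℝ (f j) (π j x)).comp (π j)) := fun x =>
    ((hk.hasFDerivAt (F' x)).comp x (hdF' x)).fderiv
  have hJe : ∀ ω j, π j (fun l => (J (e.symm l).1 (e.symm l).2 : Ω → ℝ) ω) =
      fun i => (J j i : Ω → ℝ) ω := fun ω j => funext fun i =>
    congrArg (fun s : Σ j, Fin (n j) => (J s.1 s.2 : Ω → ℝ) ω) (e.symm_apply_apply ⟨j, i⟩)
  have hXF : ∀ ω, L (F' (fun l => (J (e.symm l).1 (e.symm l).2 : Ω → ℝ) ω)) = X ω := fun ω => by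
    simp only [F', hJe, hL, hXe, hFe]
  have hreal : IsSmoothReal P T W q (fun ω => g (X ω)) (fun ω t =>
      ∑ l, fderiv ℝ (fun x => g (L (F' x))) (fun l => (J (e.symm l).1 (e.symm l).2 : Ω → ℝ) ω)
        (Pi.single l 1) • φ (e.symm l).1 (e.symm l).2 t) := by
    refine ⟨_, fun x => g (L (F' x)), fun l => φ (e.symm l).1 (e.symm l).2,
      fun l => J (e.symm l).1 (e.symm l).2, ⟨hk.contDiff.comp hF', ?_⟩, fun l => hφ _ _,
      fun l => hJ _ _, fun ω => ?_, fun ω t => rfl⟩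
    · have hpoly : PolyGrowth fun x : Fin (∑ j, n j) → ℝ =>
          ((C * ‖L‖₊ : ℝ≥0) : ℝ) * ∑ j, ‖fderiv ℝ (f j) (π j x)‖ :=
        (PolyGrowth.sum _ fun j =>
          PolyGrowth.comp (u := fun y => ‖fderiv ℝ (f j) y‖) (hf j).2 (hπ j)).const_mul
            (NNReal.coe_nonneg _)
      refine hpoly.mono fun x => ?_
      rw [hd]
      refine (ContinuousLinearMap.opNorm_comp_le _ _).trans ?_
      refine mul_le_mul (hk.norm_le _) ?_ (norm_nonneg _) (NNReal.coe_nonneg _)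
      have hs : 0 ≤ ∑ j, ‖fderiv ℝ (f j) (π j x)‖ := Finset.sum_nonneg fun j _ => norm_nonneg _
      refine ContinuousLinearMap.opNorm_le_bound _ hs fun v => ?_
      refine (pi_norm_le_iff_of_nonneg (by positivity)).2 fun j => ?_
      calc ‖fderiv ℝ (f j) (π j x) (π j v)‖ ≤ ‖fderiv ℝ (f j) (π j x)‖ * ‖π j v‖ :=
            ContinuousLinearMap.le_opNorm _ _
        _ ≤ _ := mul_le_mul (Finset.single_le_sum (f := fun j => ‖fderiv ℝ (f j) (π j x)‖)
            (fun j _ => norm_nonneg _) (Finset.mem_univ j)) (hπ j v) (norm_nonneg _) hs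
    · exact congrArg g (hXF ω).symm
  refine ⟨1, fun _ => 1, fun _ => _, fun _ => _, fun _ => hreal, fun ω => by simp, fun ω t => ?_⟩
  ext v
  simp only [ContinuousLinearMap.comp_apply, hDX, Finset.univ_unique, Finset.sum_singleton,
    ContinuousLinearMap.smulRight_apply, innerSL_apply_apply, smul_eq_mul, mul_one,
    inner_sum_fderiv_single, sum_apply, hDF]
  rw [hd, hXF, ContinuousLinearMap.comp_apply, ContinuousLinearMap.comp_apply, hL]
  congr 1
  refine Finset.sum_congr rfl fun j _ => ?_
  congr 1
  simp only [ContinuousLinearMap.pi_apply, ContinuousLinearMap.comp_apply, hJe]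
  congr 1
  exact funext fun i => (congrArg (fun s : Σ j, Fin (n j) => ⟪φ s.1 s.2 t, v⟫)
    (e.symm_apply_apply ⟨j, i⟩)).symm

end Smooth

/-! ### The closure of the Malliavin derivative -/

section Closure

variable {Ω : Type*} [MeasurableSpace Ω] {P : Measure Ω} [IsProbabilityMeasure P]
  {H₀ : Type*} [NormedAddCommGroup H₀] [InnerProductSpace ℝ H₀] [CompleteSpace H₀]
  [TopologicalSpace.SeparableSpace H₀]
  {U V : Type*} [NormedAddCommGroup U] [InnerProductSpace ℝ U]
  [NormedAddCommGroup V] [InnerProductSpace ℝ V]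
  {T : ℝ} {W : ℝ → H₀ →L[ℝ] Lp ℝ 2 P} {p q : ℝ≥0∞}

theorem memLp_comp_lipschitzWith {E F : Type*} [NormedAddCommGroup E] [NormedAddCommGroup F]
    {g : E → F} {C : ℝ≥0} (hg : LipschitzWith C g) {X : Ω → E} (hX : MemLp X p P) :
    MemLp (fun ω => g (X ω)) p P := by
  have h : LipschitzWith C fun x => g x - g 0 :=
    LipschitzWith.of_dist_le_mul fun x y => by
      rw [dist_sub_right]; exact hg.dist_le_mul x y
  have h2 := (h.comp_memLp (by simp) hX).add (memLp_const (g 0))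
  simpa [Function.comp_def, Pi.add_def] using h2

theorem ae_lt_top_of_eLpNorm_ne_top {α : Type*} [MeasurableSpace α] {μ : Measure α} (hp0 : p ≠ 0)
    (hp : p ≠ ∞) {f : α → ℝ≥0∞} (hf : AEMeasurable f μ) (hfin : eLpNorm f p μ ≠ ∞) :
    ∀ᵐ x ∂μ, f x < ∞ := by
  have hpp : 0 < p.toReal := ENNReal.toReal_pos hp0 hp
  simp only [eLpNorm_eq_lintegral_rpow_enorm_toReal hp0 hp, enorm_eq_self] at hfin
  have h : ∫⁻ x, f x ^ p.toReal ∂μ ≠ ∞ := by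
    intro h
    rw [h] at hfin
    exact hfin (ENNReal.top_rpow_of_pos (by positivity))
  filter_upwards [ae_lt_top' (hf.pow_const _) h] with x hx
  by_contra hx'
  rw [not_lt, top_le_iff] at hx'
  rw [hx', ENNReal.top_rpow_of_pos hpp] at hx
  exact lt_irrefl _ hx

omit [IsProbabilityMeasure P] in
/-- Dominated convergence for the norm of `L^p(Ω, L^p([0,T], ℒ₂(H₀,U)))`. -/
theorem tendsto_mixedNorm_zero (hp0 : p ≠ 0) (hp : p ≠ ∞) {R : ℕ → Ω → ℝ → H₀ →L[ℝ] U}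
    {G : Ω × ℝ → ℝ≥0∞} (hR : ∀ n, OpMeasurable P T (R n))
    (hle : ∀ n x, hsNorm (R n x.1 x.2) ≤ G x)
    (hG : eLpNorm G p (P.prod (timeMeasure T)) ≠ ∞)
    (hlim : ∀ᵐ x ∂(P.prod (timeMeasure T)),
      Tendsto (fun n => hsNorm (R n x.1 x.2)) atTop (𝓝 0)) :
    Tendsto (fun n => mixedNorm P T p p (R n)) atTop (𝓝 0) := by
  simp_rw [fun n => mixedNorm_eq_eLpNorm_prod hp0 hp (hR n)]
  exact tendsto_eLpNorm_zero hp0 hp (fun n => aemeasurable_hsNorm (hR n))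
    (fun n => ae_of_all _ (hle n)) hG hlim

namespace HasMalliavinDeriv

theorem mono_exponent {p' : ℝ≥0∞} (hpp : p ≤ p') (hq0 : q ≠ 0) (hq : q ≠ ∞)
    {X : Ω → U} {Z : Ω → ℝ → H₀ →L[ℝ] U}
    (h : HasMalliavinDeriv P T W p' q X Z) : HasMalliavinDeriv P T W p q X Z := by
  obtain ⟨hX, hZ, Y, DY, hY, hYX, hDYZ⟩ := h
  refine ⟨hX.mono_exponent hpp, ⟨hZ.1, (mixedNorm_mono_exponent hpp hq0 hq hZ.1).trans_lt hZ.2⟩,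
    Y, DY, hY, ?_, ?_⟩
  · refine tendsto_of_tendsto_of_tendsto_of_le_of_le tendsto_const_nhds hYX (fun _ => zero_le)
      fun n => ?_
    exact eLpNorm_le_eLpNorm_of_exponent_le hpp ((hY n).aestronglyMeasurable.sub hX.1)
  · refine tendsto_of_tendsto_of_tendsto_of_le_of_le tendsto_const_nhds hDYZ (fun _ => zero_le)
      fun n => ?_
    exact mixedNorm_mono_exponent hpp hq0 hq fun h => ((hY n).opMeasurable h).sub (hZ.1 h)

omit [IsProbabilityMeasure P] [TopologicalSpace.SeparableSpace H₀] in
theorem clm (A : U →L[ℝ] V) {X : Ω → U} {Z : Ω → ℝ → H₀ →L[ℝ] U}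
    (h : HasMalliavinDeriv P T W p q X Z) :
    HasMalliavinDeriv P T W p q (fun ω => A (X ω)) (fun ω t => A ∘L Z ω t) := by
  obtain ⟨hX, hZ, Y, DY, hY, hYX, hDYZ⟩ := h
  refine ⟨A.comp_memLp' hX, ⟨fun h => A.continuous.comp_aestronglyMeasurable (hZ.1 h), ?_⟩,
    fun n ω => A (Y n ω), fun n ω t => A ∘L DY n ω t, fun n => (hY n).clm A, ?_, ?_⟩
  · refine (mixedNorm_le_mul (c := ‖A‖₊) (R := Z) fun ω t v => ?_).trans_lt
      (ENNReal.mul_lt_top ENNReal.coe_lt_top hZ.2)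
    exact A.le_opENorm _
  · have h0 := ENNReal.Tendsto.const_mul hYX (Or.inr (ENNReal.coe_ne_top (r := ‖A‖₊)))
    rw [mul_zero] at h0
    refine tendsto_of_tendsto_of_tendsto_of_le_of_le tendsto_const_nhds h0 (fun _ => zero_le)
      fun n => ?_
    refine eLpNorm_le_nnreal_smul_eLpNorm_of_ae_le_mul' (ae_of_all _ fun ω => ?_) p
    rw [← map_sub]
    exact A.le_opENorm _
  · have h0 := ENNReal.Tendsto.const_mul hDYZ (Or.inr (ENNReal.coe_ne_top (r := ‖A‖₊)))
    rw [mul_zero] at h0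
    refine tendsto_of_tendsto_of_tendsto_of_le_of_le tendsto_const_nhds h0 (fun _ => zero_le)
      fun n => ?_
    refine mixedNorm_le_mul fun ω t v => ?_
    rw [← ContinuousLinearMap.comp_sub]
    exact A.le_opENorm _

theorem add (hp1 : 1 ≤ p) (hp : p ≠ ∞) {X X' : Ω → U} {Z Z' : Ω → ℝ → H₀ →L[ℝ] U}
    (h : HasMalliavinDeriv P T W p p X Z) (h' : HasMalliavinDeriv P T W p p X' Z') :
    HasMalliavinDeriv P T W p p (fun ω => X ω + X' ω) (fun ω t => Z ω t + Z' ω t) := by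
  obtain ⟨hX, hZ, Y, DY, hY, hYX, hDYZ⟩ := h
  obtain ⟨hX', hZ', Y', DY', hY', hYX', hDYZ'⟩ := h'
  refine ⟨hX.add hX', ⟨fun h => (hZ.1 h).add (hZ'.1 h),
    (mixedNorm_add_le hp1 hp hZ.1 hZ'.1).trans_lt (ENNReal.add_lt_top.2 ⟨hZ.2, hZ'.2⟩)⟩,
    fun n ω => Y n ω + Y' n ω, fun n ω t => DY n ω t + DY' n ω t, fun n => (hY n).add (hY' n),
    ?_, ?_⟩
  · have h0 := hYX.add hYX'
    rw [add_zero] at h0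
    refine tendsto_of_tendsto_of_tendsto_of_le_of_le tendsto_const_nhds h0 (fun _ => zero_le)
      fun n => ?_
    simp_rw [add_sub_add_comm]
    exact eLpNorm_add_le ((hY n).aestronglyMeasurable.sub hX.1)
      ((hY' n).aestronglyMeasurable.sub hX'.1) hp1
  · have h0 := hDYZ.add hDYZ'
    rw [add_zero] at h0
    refine tendsto_of_tendsto_of_tendsto_of_le_of_le tendsto_const_nhds h0 (fun _ => zero_le)
      fun n => ?_
    simp_rw [add_sub_add_comm]
    exact mixedNorm_add_le hp1 hp (fun h => ((hY n).opMeasurable h).sub (hZ.1 h))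
      fun h => ((hY' n).opMeasurable h).sub (hZ'.1 h)

omit [IsProbabilityMeasure P] [TopologicalSpace.SeparableSpace H₀] in
theorem zero : HasMalliavinDeriv P T W p p (fun _ => (0 : U)) (fun _ _ => 0) := by
  have h0 : mixedNorm P T p p (fun _ _ => (0 : H₀ →L[ℝ] U)) = 0 := by
    simp [mixedNorm, hsNorm]
  refine ⟨MemLp.zero', ⟨fun h => by simpa using aestronglyMeasurable_const, by simp [h0]⟩,
    fun _ _ => 0, fun _ _ _ => 0, fun n => ?_, by simp, by simp [h0]⟩
  exact ⟨0, Fin.elim0, Fin.elim0, Fin.elim0, fun j => j.elim0, by simp, by simp⟩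

theorem sum (hp1 : 1 ≤ p) (hp : p ≠ ∞) {ι : Type*} (s : Finset ι) {X : ι → Ω → U}
    {Z : ι → Ω → ℝ → H₀ →L[ℝ] U} (h : ∀ i, HasMalliavinDeriv P T W p p (X i) (Z i)) :
    HasMalliavinDeriv P T W p p (fun ω => ∑ i ∈ s, X i ω) (fun ω t => ∑ i ∈ s, Z i ω t) := by
  classical
  induction s using Finset.induction_on with
  | empty => simpa using zero
  | insert a s ha ih => simpa [Finset.sum_insert ha] using (h a).add hp1 hp ih

/-- The graph of the Malliavin derivative is sequentially closed. -/
theorem of_tendsto (hp1 : 1 ≤ p) (hp : p ≠ ∞) {X : ℕ → Ω → U} {Z : ℕ → Ω → ℝ → H₀ →L[ℝ] U}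
    (h : ∀ n, HasMalliavinDeriv P T W p p (X n) (Z n)) {X' : Ω → U} {Z' : Ω → ℝ → H₀ →L[ℝ] U}
    (hX' : MemLp X' p P) (hZ' : MemMixed P T p p Z')
    (hX : Tendsto (fun n => eLpNorm (fun ω => X n ω - X' ω) p P) atTop (𝓝 0))
    (hZ : Tendsto (fun n => mixedNorm P T p p (fun ω t => Z n ω t - Z' ω t)) atTop (𝓝 0)) :
    HasMalliavinDeriv P T W p p X' Z' := by
  have key : ∀ n : ℕ, ∃ (Y : Ω → U) (DY : Ω → ℝ → H₀ →L[ℝ] U), IsSmooth P T W p Y DY ∧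
      eLpNorm (fun ω => Y ω - X n ω) p P ≤ (n : ℝ≥0∞)⁻¹ ∧
      mixedNorm P T p p (fun ω t => DY ω t - Z n ω t) ≤ (n : ℝ≥0∞)⁻¹ := fun n => by
    obtain ⟨-, -, Y, DY, hY, h1, h2⟩ := h n
    have hn : 0 < (n : ℝ≥0∞)⁻¹ := by simp
    obtain ⟨k, hk1, hk2⟩ := ((h1.eventually (ge_mem_nhds hn)).and
      (h2.eventually (ge_mem_nhds hn))).exists
    exact ⟨Y k, DY k, hY k, hk1, hk2⟩
  choose Y DY hY hYX hDYZ using key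
  refine ⟨hX', hZ', Y, DY, hY, ?_, ?_⟩
  · have h0 := ENNReal.tendsto_inv_nat_nhds_zero.add hX
    rw [add_zero] at h0
    refine tendsto_of_tendsto_of_tendsto_of_le_of_le tendsto_const_nhds h0 (fun _ => zero_le)
      fun n => ?_
    refine le_trans ?_ (add_le_add_left (hYX n) _)
    refine le_trans (le_of_eq ?_) (eLpNorm_add_le ((hY n).aestronglyMeasurable.sub (h n).1.1)
      ((h n).1.1.sub hX'.1) hp1)
    simp [Pi.add_def]
  · have h0 := ENNReal.tendsto_inv_nat_nhds_zero.add hZ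
    rw [add_zero] at h0
    refine tendsto_of_tendsto_of_tendsto_of_le_of_le tendsto_const_nhds h0 (fun _ => zero_le)
      fun n => ?_
    refine le_trans ?_ (add_le_add_left (hDYZ n) _)
    refine le_trans (le_of_eq ?_) (mixedNorm_add_le hp1 hp
      (fun h' => ((hY n).opMeasurable h').sub ((h n).2.1.1 h'))
      fun h' => ((h n).2.1.1 h').sub (hZ'.1 h'))
    simp

/-- The chain rule for a map whose derivative is strongly continuous and bounded, but possibly
discontinuous in the operator norm. -/
theorem comp (hp1 : 1 ≤ p) (hp : p ≠ ∞) {X : Ω → U} {Z : Ω → ℝ → H₀ →L[ℝ] U}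
    (h : HasMalliavinDeriv P T W p p X Z)
    {g : U → ℝ} {g' : U → U →L[ℝ] ℝ} {C : ℝ≥0} (hg : HasBddGateauxDeriv g g' C) :
    HasMalliavinDeriv P T W p p (fun ω => g (X ω)) (fun ω t => g' (X ω) ∘L Z ω t) := by
  have hp0 : p ≠ 0 := (one_pos.trans_le hp1).ne'
  obtain ⟨hX, hZ, Y, DY, hY, hYX, hDYZ⟩ := h
  -- almost sure convergence along a subsequence handles `g' (Y n) - g' X`, which need not be small
  -- in the operator norm
  obtain ⟨ns, hns, hae⟩ := (tendstoInMeasure_of_tendsto_eLpNorm hp0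
    (fun n => (hY n).aestronglyMeasurable) hX.1 hYX).exists_seq_tendsto_ae
  have hYX := hYX.comp hns.tendsto_atTop
  have hDYZ := hDYZ.comp hns.tendsto_atTop
  have hgle : ∀ x v, ‖g' x v‖ₑ ≤ C * ‖v‖ₑ := fun x v =>
    (g' x).le_of_opENorm_le (by exact_mod_cast hg.norm_le x) v
  have hmeas : ∀ {X : Ω → U} {Z : Ω → ℝ → H₀ →L[ℝ] U}, AEStronglyMeasurable X P →
      OpMeasurable P T Z → OpMeasurable P T (fun ω t => g' (X ω) ∘L Z ω t) := fun hX hZ h =>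
    hg.continuous_uncurry.comp_aestronglyMeasurable (hX.comp_fst.prodMk (hZ h))
  refine ⟨memLp_comp_lipschitzWith hg.lipschitzWith hX, ⟨hmeas hX.1 hZ.1, ?_⟩,
    fun n ω => g (Y (ns n) ω), fun n ω t => g' (Y (ns n) ω) ∘L DY (ns n) ω t,
    fun n => (hY _).comp hg, ?_, ?_⟩
  · exact (mixedNorm_le_mul (R := Z) fun ω t v => hgle _ _).trans_lt
      (ENNReal.mul_lt_top ENNReal.coe_lt_top hZ.2)
  · have h0 := ENNReal.Tendsto.const_mul hYX (Or.inr (ENNReal.coe_ne_top (r := C)))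
    rw [mul_zero] at h0
    refine tendsto_of_tendsto_of_tendsto_of_le_of_le tendsto_const_nhds h0 (fun _ => zero_le)
      fun n => ?_
    refine eLpNorm_le_nnreal_smul_eLpNorm_of_ae_le_mul' (ae_of_all _ fun ω => ?_) p
    rw [← edist_eq_enorm_sub, ← edist_eq_enorm_sub]
    exact hg.lipschitzWith _ _
  · have h0 := ENNReal.Tendsto.const_mul hDYZ (Or.inr (ENNReal.coe_ne_top (r := C)))
    have h1 : Tendsto (fun n => mixedNorm P T p p (fun ω t => g' (Y (ns n) ω) ∘L Z ω t -
        g' (X ω) ∘L Z ω t)) atTop (𝓝 0) := by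
      have hle : ∀ n ω t v, ‖(g' (Y (ns n) ω) ∘L Z ω t - g' (X ω) ∘L Z ω t) v‖ₑ ≤
          (2 * C : ℝ≥0) * ‖Z ω t v‖ₑ := fun n ω t v => by
        refine (enorm_sub_le).trans ((add_le_add (hgle _ _) (hgle _ _)).trans (le_of_eq ?_))
        push_cast
        ring
      refine tendsto_mixedNorm_zero hp0 hp
        (G := fun x => (2 * C : ℝ≥0) * hsNorm (Z x.1 x.2)) (fun n h => ?_) (fun n x => ?_) ?_ ?_
      · exact (hmeas (hY _).aestronglyMeasurable hZ.1 h).sub (hmeas hX.1 hZ.1 h)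
      · exact hsNorm_le_mul (hle n x.1 x.2)
      · refine ((eLpNorm_le_nnreal_smul_eLpNorm_of_ae_le_mul' (c := 2 * C)
          (g := fun x : Ω × ℝ => hsNorm (Z x.1 x.2))
          (ae_of_all _ fun x => by simp [enorm_eq_self]) p).trans_lt
          (ENNReal.mul_lt_top ENNReal.coe_lt_top ?_)).ne
        rw [← mixedNorm_eq_eLpNorm_prod hp0 hp hZ.1]
        exact hZ.2
      · have hfin := ae_lt_top_of_eLpNorm_ne_top hp0 hp (aemeasurable_hsNorm hZ.1)
          (by rw [← mixedNorm_eq_eLpNorm_prod hp0 hp hZ.1]; exact hZ.2.ne)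
        filter_upwards [hfin, Measure.quasiMeasurePreserving_fst.ae hae] with x hx1 hx2
        refine tendsto_hsNorm_zero ENNReal.coe_ne_top hx1.ne (fun n => hle n x.1 x.2) fun v => ?_
        have := ((hg.continuous_apply (Z x.1 x.2 v)).tendsto (X x.1)).comp hx2
        simpa [Function.comp_def] using this.sub_const (g' (X x.1) (Z x.1 x.2 v))
    have h2 := h0.add h1
    rw [mul_zero, add_zero] at h2
    refine tendsto_of_tendsto_of_tendsto_of_le_of_le tendsto_const_nhds h2 (fun _ => zero_le)
      fun n => ?_
    have hDm : OpMeasurable P T fun ω t => DY (ns n) ω t - Z ω t := fun h =>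
      ((hY (ns n)).opMeasurable h).sub (hZ.1 h)
    have hm := hmeas (hY (ns n)).aestronglyMeasurable hDm
    have heq : (fun ω t => g' (Y (ns n) ω) ∘L DY (ns n) ω t - g' (X ω) ∘L Z ω t) = fun ω t =>
        g' (Y (ns n) ω) ∘L (DY (ns n) ω t - Z ω t) +
          (g' (Y (ns n) ω) ∘L Z ω t - g' (X ω) ∘L Z ω t) := by
      ext; simp
    rw [heq]
    refine (mixedNorm_add_le hp1 hp hm fun h =>
      (hmeas (hY _).aestronglyMeasurable hZ.1 h).sub (hmeas hX.1 hZ.1 h)).trans ?_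
    refine add_le_add_left ?_ _
    exact mixedNorm_le_mul fun ω t v => hgle _ _

end HasMalliavinDeriv

end Closure

/-! ### The derivatives of maps in `𝒢_b²` -/

section Derivatives

variable {U V : Type*} [NormedAddCommGroup U] [NormedSpace ℝ U]
  [NormedAddCommGroup V] [NormedSpace ℝ V]

omit [NormedSpace ℝ U] [NormedSpace ℝ V] in
theorem enorm_le_formNorm_mul {k : ℕ} {b : (Fin k → U) → V} (hb : formNorm b ≠ ∞) (u : Fin k → U) :
    ‖b u‖ₑ ≤ formNorm b * ∏ i, ‖u i‖ₑ := by
  have hfin : ∏ i, ‖u i‖ₑ ≠ ∞ := ENNReal.prod_ne_top fun i _ => enorm_ne_top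
  by_cases h0 : ∏ i, ‖u i‖ₑ = 0
  · have hne : {C : ℝ≥0∞ | ∀ u : Fin k → U, ‖b u‖ₑ ≤ C * ∏ i, ‖u i‖ₑ}.Nonempty := by
      rw [Set.nonempty_iff_ne_empty]
      intro h
      rw [formNorm, h, sInf_empty] at hb
      exact hb rfl
    obtain ⟨C, hC⟩ := hne
    have := hC u
    rw [h0, mul_zero] at this ⊢
    exact this
  · rw [← ENNReal.div_le_iff h0 hfin]
    refine le_sInf fun C hC => ?_
    rw [ENNReal.div_le_iff h0 hfin]
    exact hC u

theorem enorm_gDeriv_le {η : U → V} {k : ℕ} (hk : gSeminorm k η < ∞) (x : U) (u : Fin k → U) :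
    ‖gDeriv η k x u‖ₑ ≤ gSeminorm k η * ∏ i, ‖u i‖ₑ := by
  have h : formNorm (gDeriv η k x) ≤ gSeminorm k η := le_iSup (fun x => formNorm (gDeriv η k x)) x
  exact (enorm_le_formNorm_mul (h.trans_lt hk).ne u).trans (mul_le_mul_left h _)

/-- The first two derivatives of a map in `𝒢_b²(U,V)` as bounded linear and bilinear maps. The
Gateaux derivative of `x ↦ η'(x)·e` is `η''(x)·(e, ·)`. -/
theorem IsGb.exists_hasBddGateauxDeriv {η : U → V} (hη : IsGb 2 η) :
    ∃ (D : U → U →L[ℝ] V) (D2 : U → U →L[ℝ] U →L[ℝ] V),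
      HasBddGateauxDeriv η D (gSeminorm 1 η).toNNReal ∧
      ∀ e, HasBddGateauxDeriv (fun x => D x e) (fun x => D2 x e)
        ((gSeminorm 2 η).toNNReal * ‖e‖₊) := by
  obtain ⟨hG, hfin⟩ := hη
  have h1 := hfin 1 le_rfl (by norm_num)
  have h2 := hfin 2 (by norm_num) le_rfl
  choose B hB using hG.multilinear 1 le_rfl (by norm_num)
  choose B2 hB2 using hG.multilinear 2 (by norm_num) le_rfl
  have hD : ∀ x v, continuousMultilinearCurryFin1 ℝ U V (B x) v = gDeriv η 1 x (fun _ => v) := by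
    intro x v
    rw [continuousMultilinearCurryFin1_apply, hB]
    congr 1
  let D2 : U → U →L[ℝ] U →L[ℝ] V := fun x =>
    (continuousMultilinearCurryFin1 ℝ U V).toContinuousLinearEquiv.toContinuousLinearMap ∘L
      (B2 x).curryLeft
  have hD2 : ∀ x e v, D2 x e v = gDeriv η 2 x ![e, v] := by
    intro x e v
    change continuousMultilinearCurryFin1 ℝ U V ((B2 x).curryLeft e) v = _
    rw [continuousMultilinearCurryFin1_apply, ContinuousMultilinearMap.curryLeft_apply, hB2]
    congr 1
    ext i
    fin_cases i
    · rfl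
    · rfl
  refine ⟨fun x => continuousMultilinearCurryFin1 ℝ U V (B x), D2, ⟨fun x v => ?_, fun v => ?_,
    fun x => ?_⟩, fun e => ⟨fun x v => ?_, fun v => ?_, fun x => ?_⟩⟩
  · rw [hD]
    exact (hG.exists_limit 0 (by norm_num) x (fun _ => v)).hasLineDerivAt
  · simp_rw [hD]
    exact hG.strongly_continuous 1 le_rfl (by norm_num) _
  · refine ContinuousLinearMap.opNorm_le_bound _ (NNReal.coe_nonneg _) fun v => ?_
    have := enorm_gDeriv_le h1 x (fun _ => v)
    rw [← hD, ← ENNReal.coe_toNNReal h1.ne] at this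
    simp only [Finset.univ_unique, Finset.prod_singleton, enorm_eq_nnnorm, ← ENNReal.coe_mul,
      ENNReal.coe_le_coe] at this
    exact this
  · simp_rw [hD, hD2]
    have := (hG.exists_limit 1 (by norm_num) x ![e, v]).hasLineDerivAt
    have he : (fun i : Fin 1 => (![e, v] : Fin 2 → U) i.castSucc) = fun _ => e := by
      ext i
      rw [Subsingleton.elim i 0]; rfl
    simp only [he] at this
    refine Eq.mp ?_ this
    change HasLineDerivAt ℝ _ (lineDeriv ℝ (fun y => gDeriv η 1 y fun _ => e) x v) x v =
      HasLineDerivAt ℝ _ (lineDeriv ℝ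
        (fun y => gDeriv η 1 y (fun i : Fin 1 => (![e, v] : Fin 2 → U) i.castSucc)) x v) x v
    rw [he]
  · simp_rw [hD2]
    exact hG.strongly_continuous 2 (by norm_num) le_rfl _
  · refine ContinuousLinearMap.opNorm_le_bound _ (NNReal.coe_nonneg _) fun v => ?_
    have := enorm_gDeriv_le h2 x ![e, v]
    rw [← hD2, ← ENNReal.coe_toNNReal h2.ne] at this
    simp only [Fin.prod_univ_two, Matrix.cons_val_zero, Matrix.cons_val_one, ← mul_assoc,
      enorm_eq_nnnorm, ← ENNReal.coe_mul, ENNReal.coe_le_coe] at this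
    exact this

end Derivatives

/-! ### Damping of large vectors -/

section Truncation

variable {V : Type*} [NormedAddCommGroup V] [InnerProductSpace ℝ V]

/-- The bounded smooth map `y ↦ y / (1 + s‖y‖²)`, which tends to the identity as `s → 0`. -/
noncomputable def damp (s : ℝ) (y : V) : V := (1 + s * ‖y‖ ^ 2)⁻¹ • y

/-- The derivative of `damp s`. -/
noncomputable def dampDeriv (s : ℝ) (y : V) : V →L[ℝ] V :=
  (1 + s * ‖y‖ ^ 2)⁻¹ • ContinuousLinearMap.id ℝ V -
    (2 * s * ((1 + s * ‖y‖ ^ 2) ^ 2)⁻¹) • (innerSL ℝ y).smulRight y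

theorem dampDeriv_apply (s : ℝ) (y v : V) : dampDeriv s y v =
    (1 + s * ‖y‖ ^ 2)⁻¹ • v - (2 * s * ((1 + s * ‖y‖ ^ 2) ^ 2)⁻¹) • ⟪y, v⟫ • y := by
  simp [dampDeriv]

variable {s : ℝ} (hs : 0 < s)

include hs

theorem hasFDerivAt_damp (y : V) : HasFDerivAt (damp s) (dampDeriv s y) y := by
  have h0 : 1 + s * ‖y‖ ^ 2 ≠ 0 := by positivity
  have h1 : HasFDerivAt (fun y : V => (1 + s * ‖y‖ ^ 2)) (s • (2 : ℕ) • innerSL ℝ y) y :=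
    (((hasStrictFDerivAt_norm_sq y).hasFDerivAt).const_mul s).const_add 1
  have h2 := ((hasDerivAt_inv h0).comp_hasFDerivAt y h1).smul (hasFDerivAt_id (𝕜 := ℝ) y)
  refine h2.congr_fderiv ?_
  ext v
  simp only [dampDeriv_apply, add_apply, smul_apply, ContinuousLinearMap.smulRight_apply,
    ContinuousLinearMap.id_apply, innerSL_apply_apply, id, Function.comp_apply]
  module

theorem continuous_dampDeriv_apply (v : V) : Continuous fun y : V => dampDeriv s y v := by
  simp_rw [dampDeriv_apply]
  have h0 : ∀ y : V, 1 + s * ‖y‖ ^ 2 ≠ 0 := fun y => by positivity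
  have h1 : ∀ y : V, (1 + s * ‖y‖ ^ 2) ^ 2 ≠ 0 := fun y => by positivity
  fun_prop (disch := assumption)

theorem norm_damp_le (y : V) : ‖damp s y‖ ≤ ‖y‖ := by
  rw [damp, norm_smul, norm_inv, Real.norm_of_nonneg (by positivity)]
  refine mul_le_of_le_one_left (norm_nonneg _) (inv_le_one_of_one_le₀ ?_)
  have : 0 ≤ s * ‖y‖ ^ 2 := by positivity
  linarith

theorem norm_damp_le_const (y : V) : ‖damp s y‖ ≤ 1 + s⁻¹ := by
  rw [damp, norm_smul, norm_inv, Real.norm_of_nonneg (by positivity),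
    inv_mul_le_iff₀ (by positivity)]
  have h1 : s⁻¹ * (s * ‖y‖ ^ 2) = ‖y‖ ^ 2 := by field_simp
  have h2 : 0 ≤ s * ‖y‖ ^ 2 := by positivity
  have h3 : 0 < s⁻¹ := by positivity
  nlinarith [sq_nonneg (‖y‖ - 1), norm_nonneg y]

theorem norm_dampDeriv_le (y : V) : ‖dampDeriv s y‖ ≤ 2 := by
  refine ContinuousLinearMap.opNorm_le_bound _ (by norm_num) fun v => ?_
  rw [dampDeriv_apply]
  refine (norm_sub_le _ _).trans ?_
  have hq : 0 ≤ s * ‖y‖ ^ 2 := by positivity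
  rw [norm_smul, norm_smul, norm_smul, Real.norm_of_nonneg (by positivity),
    Real.norm_of_nonneg (by positivity)]
  calc (1 + s * ‖y‖ ^ 2)⁻¹ * ‖v‖ + 2 * s * ((1 + s * ‖y‖ ^ 2) ^ 2)⁻¹ * (‖⟪y, v⟫‖ * ‖y‖)
      ≤ (1 + s * ‖y‖ ^ 2)⁻¹ * ‖v‖ +
          2 * s * ((1 + s * ‖y‖ ^ 2) ^ 2)⁻¹ * (‖y‖ * ‖v‖ * ‖y‖) := by
        gcongr; exact norm_inner_le_norm y v
    _ = ((1 + 3 * (s * ‖y‖ ^ 2)) / (1 + s * ‖y‖ ^ 2) ^ 2) * ‖v‖ := by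
        field_simp; ring
    _ ≤ 2 * ‖v‖ := by
        gcongr
        rw [div_le_iff₀ (by positivity)]
        nlinarith

omit hs

theorem tendsto_damp (y : V) : Tendsto (fun s : ℝ => damp s y) (𝓝 0) (𝓝 y) := by
  have : ContinuousAt (fun s : ℝ => damp s y) 0 := by
    unfold damp
    refine ContinuousAt.smul (ContinuousAt.inv₀ (by fun_prop) (by simp)) continuousAt_const
  simpa [ContinuousAt, damp] using this

theorem tendsto_dampDeriv (y : V) : Tendsto (fun s : ℝ => dampDeriv s y) (𝓝 0)
    (𝓝 (ContinuousLinearMap.id ℝ V)) := by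
  have h1 : Tendsto (fun s : ℝ => (1 + s * ‖y‖ ^ 2)⁻¹) (𝓝 0) (𝓝 1) := by
    have : ContinuousAt (fun s : ℝ => (1 + s * ‖y‖ ^ 2)⁻¹) 0 :=
      ContinuousAt.inv₀ (by fun_prop) (by simp)
    simpa [ContinuousAt] using this
  have h2 : Tendsto (fun s : ℝ => 2 * s * ((1 + s * ‖y‖ ^ 2) ^ 2)⁻¹) (𝓝 0) (𝓝 0) := by
    have : ContinuousAt (fun s : ℝ => 2 * s * ((1 + s * ‖y‖ ^ 2) ^ 2)⁻¹) 0 :=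
      ContinuousAt.mul (by fun_prop) (ContinuousAt.inv₀ (by fun_prop) (by simp))
    simpa [ContinuousAt] using this
  have h3 := (h1.smul_const (ContinuousLinearMap.id ℝ V)).sub
    (h2.smul_const ((innerSL ℝ y).smulRight y))
  rw [one_smul, zero_smul, sub_zero] at h3
  exact h3

end Truncation

/-! ### Finite-rank projections -/

section Projection

variable {U : Type*} [NormedAddCommGroup U] [InnerProductSpace ℝ U]

/-- The orthogonal projection onto the span of `b i`, `i ∈ s`, for an orthonormal family `b`. -/
noncomputable def finProj {ι : Type*} (b : ι → U) (s : Finset ι) : U →L[ℝ] U :=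
  ∑ i ∈ s, (innerSL ℝ (b i)).smulRight (b i)

theorem finProj_apply {ι : Type*} (b : ι → U) (s : Finset ι) (x : U) :
    finProj b s x = ∑ i ∈ s, ⟪b i, x⟫ • b i := by
  simp [finProj, sum_apply]

theorem norm_finProj_apply_le {ι : Type*} {b : ι → U} (hb : Orthonormal ℝ b) (s : Finset ι)
    (x : U) : ‖finProj b s x‖ ≤ ‖x‖ := by
  have h1 : ‖finProj b s x‖ ^ 2 = ∑ i ∈ s, ‖⟪b i, x⟫‖ ^ 2 := by
    rw [← real_inner_self_eq_norm_sq, finProj_apply, hb.inner_sum]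
    simp [sq]
  have h2 := hb.sum_inner_products_le x (s := s)
  rw [← h1] at h2
  exact (sq_le_sq₀ (norm_nonneg _) (norm_nonneg _)).1 h2

theorem tendsto_finProj {ι : Type*} (b : HilbertBasis ι ℝ U) (x : U) :
    Tendsto (fun s => finProj b s x) atTop (𝓝 x) := by
  have h : HasSum (fun i => ⟪b i, x⟫ • b i) x := by
    simpa [HilbertBasis.repr_apply_apply] using b.hasSum_repr x
  simp_rw [finProj_apply]
  exact h

/-- Finite-rank orthogonal projections may be applied to a convergent sequence. -/
theorem tendsto_finProj_apply {ι : Type*} (b : HilbertBasis ι ℝ U) {F : ℕ → Finset ι}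
    (hF : Tendsto F atTop atTop) {w : ℕ → U} {x : U} (hw : Tendsto w atTop (𝓝 x)) :
    Tendsto (fun n => finProj b (F n) (w n)) atTop (𝓝 x) := by
  have h1 : Tendsto (fun n => finProj b (F n) (w n - x)) atTop (𝓝 0) := by
    refine squeeze_zero_norm (fun n => norm_finProj_apply_le b.orthonormal _ _) ?_
    simpa using (hw.sub_const x).norm
  simpa using h1.add ((tendsto_finProj b x).comp hF)

end Projection

/-! ### Operators that represent bilinear forms -/

section FormOperator

variable {U V : Type*} [NormedAddCommGroup U] [InnerProductSpace ℝ U] [CompleteSpace U]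
  [NormedAddCommGroup V] [InnerProductSpace ℝ V] [CompleteSpace V]

/-- For a bilinear map `B : U × U → V` and `y ∈ V`, the operator on `U` that represents the
bilinear form `⟨B(·,·), y⟩`, in the sense that `⟪formOp B y u, e⟫ = ⟪y, B e u⟫`. -/
noncomputable def formOp (B : U →L[ℝ] U →L[ℝ] V) (y : V) : U →L[ℝ] U :=
  LinearMap.mkContinuous
    { toFun := fun u => ContinuousLinearMap.adjoint (B.flip u) y
      map_add' := fun u v => by simp
      map_smul' := fun c u => by simp }
    (‖B‖ * ‖y‖) fun u => by
      have h := (ContinuousLinearMap.adjoint (B.flip u)).le_opNorm y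
      rw [LinearIsometryEquiv.norm_map] at h
      refine h.trans ?_
      have := B.flip.le_opNorm u
      rw [ContinuousLinearMap.opNorm_flip] at this
      calc ‖B.flip u‖ * ‖y‖ ≤ ‖B‖ * ‖u‖ * ‖y‖ := by gcongr
        _ = _ := by ring

theorem inner_formOp (B : U →L[ℝ] U →L[ℝ] V) (y : V) (u e : U) :
    ⟪e, formOp B y u⟫ = ⟪B e u, y⟫ := by
  change ⟪e, ContinuousLinearMap.adjoint (B.flip u) y⟫ = _
  rw [ContinuousLinearMap.adjoint_inner_right, ContinuousLinearMap.flip_apply]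

theorem formOp_sub (B : U →L[ℝ] U →L[ℝ] V) (y z : V) :
    formOp B (y - z) = formOp B y - formOp B z := by
  ext u
  change ContinuousLinearMap.adjoint (B.flip u) (y - z) =
    ContinuousLinearMap.adjoint (B.flip u) y - ContinuousLinearMap.adjoint (B.flip u) z
  exact map_sub _ _ _

theorem norm_formOp_apply_le {B : U →L[ℝ] U →L[ℝ] V} {b : ℝ≥0} (hB : ∀ e, ‖B e‖ ≤ b * ‖e‖)
    (y : V) (u : U) : ‖formOp B y u‖ ≤ b * ‖y‖ * ‖u‖ := by
  have h := (formOp B y).le_opNorm u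
  refine h.trans ?_
  gcongr
  refine (LinearMap.mkContinuous_norm_le _ (by positivity) _).trans ?_
  gcongr
  exact B.opNorm_le_bound b.2 hB

end FormOperator

/-! ### Coordinates of the damped product -/

section ProductMap

variable {U V : Type*} [NormedAddCommGroup U] [InnerProductSpace ℝ U]
  [NormedAddCommGroup V] [InnerProductSpace ℝ V]

/-- For fixed `e`, the scalar function `(x, y) ↦ ⟨D(x)e, y/(1 + s‖y‖²)⟩` on `U × V` has a bounded
Gateaux derivative. The damping of `y` keeps the derivative in the direction of `x` bounded. -/
theorem hasBddGateauxDeriv_inner_damp {D : U → U →L[ℝ] V} {D2 : U → U →L[ℝ] U →L[ℝ] V}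
    {a b : ℝ≥0} (hD : ∀ x, ‖D x‖ ≤ a)
    (hD2 : ∀ e, HasBddGateauxDeriv (fun x => D x e) (fun x => D2 x e) (b * ‖e‖₊))
    (e : U) {s : ℝ≥0} (hs : 0 < s) :
    HasBddGateauxDeriv (fun z : WithLp 2 (U × V) => ⟪D z.fst e, damp (s : ℝ) z.snd⟫)
      (fun z => (innerSL ℝ (damp (s : ℝ) z.snd)) ∘L D2 z.fst e ∘L WithLp.fstL 2 ℝ U V +
        (innerSL ℝ (D z.fst e)) ∘L dampDeriv (s : ℝ) z.snd ∘L WithLp.sndL 2 ℝ U V)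
      ((1 + s⁻¹) * (b * ‖e‖₊) + a * ‖e‖₊ * 2) where
  hasLineDerivAt z w := by
    have hs' : (0 : ℝ) < s := hs
    have h1 : HasDerivAt (fun t : ℝ => D (z.fst + t • w.fst) e) (D2 z.fst e w.fst) 0 :=
      (hD2 e).hasLineDerivAt z.fst w.fst
    have h2 : HasDerivAt (fun t : ℝ => damp (s : ℝ) (z.snd + t • w.snd))
        (dampDeriv (s : ℝ) z.snd w.snd) 0 :=
      (hasFDerivAt_damp hs' z.snd).hasLineDerivAt w.snd
    have h3 := h1.inner ℝ h2
    simp only [zero_smul, add_zero] at h3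
    rw [real_inner_comm (damp _ _) (D2 _ _ _), add_comm] at h3
    exact h3
  continuous_apply w := by
    have hs' : (0 : ℝ) < s := hs
    have hf : Continuous fun z : WithLp 2 (U × V) => z.fst := (WithLp.fstL 2 ℝ U V).continuous
    have hsn : Continuous fun z : WithLp 2 (U × V) => z.snd := (WithLp.sndL 2 ℝ U V).continuous
    have hd : Continuous (damp (s : ℝ) : V → V) :=
      continuous_iff_continuousAt.2 fun y => (hasFDerivAt_damp hs' y).continuousAt
    exact ((hd.comp hsn).inner (((hD2 e).continuous_apply w.fst).comp hf)).add
      ((((hD2 e).continuous).comp hf).inner ((continuous_dampDeriv_apply hs' w.snd).comp hsn))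
  norm_le z := by
    have hs' : (0 : ℝ) < s := hs
    refine ContinuousLinearMap.opNorm_le_bound _ (NNReal.coe_nonneg _) fun w => ?_
    have hw1 : ‖w.fst‖ ≤ ‖w‖ := by
      have := WithLp.prod_norm_sq_eq_of_L2 w
      nlinarith [norm_nonneg w.fst, norm_nonneg w, sq_nonneg ‖w.snd‖]
    have hw2 : ‖w.snd‖ ≤ ‖w‖ := by
      have := WithLp.prod_norm_sq_eq_of_L2 w
      nlinarith [norm_nonneg w.snd, norm_nonneg w, sq_nonneg ‖w.fst‖]
    change ‖⟪damp (s : ℝ) z.snd, D2 z.fst e w.fst⟫ +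
      ⟪D z.fst e, dampDeriv (s : ℝ) z.snd w.snd⟫‖ ≤ _
    calc _ ≤ ‖damp (s : ℝ) z.snd‖ * ‖D2 z.fst e w.fst‖ +
          ‖D z.fst e‖ * ‖dampDeriv (s : ℝ) z.snd w.snd‖ :=
          (norm_add_le _ _).trans (add_le_add (norm_inner_le_norm _ _) (norm_inner_le_norm _ _))
      _ ≤ (1 + (s : ℝ)⁻¹) * (b * ‖e‖ * ‖w‖) + (a * ‖e‖) * (2 * ‖w‖) := by
          gcongr
          · exact norm_damp_le_const hs' _
          · refine ((D2 z.fst e).le_of_opNorm_le ((hD2 e).norm_le _) _).trans ?_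
            push_cast
            gcongr
          · exact (D _).le_of_opNorm_le (hD _) _
          · refine ((dampDeriv _ _).le_of_opNorm_le (norm_dampDeriv_le hs' _) _).trans ?_
            gcongr
      _ = _ := by push_cast; ring

end ProductMap

/-! ### The product rule -/

section ProductRule

variable {Ω : Type*} [MeasurableSpace Ω] {P : Measure Ω} [IsProbabilityMeasure P]
  {H₀ : Type*} [NormedAddCommGroup H₀] [InnerProductSpace ℝ H₀] [CompleteSpace H₀]
  [TopologicalSpace.SeparableSpace H₀]
  {U V : Type*} [NormedAddCommGroup U] [InnerProductSpace ℝ U] [CompleteSpace U]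
  [NormedAddCommGroup V] [InnerProductSpace ℝ V] [CompleteSpace V]
  {T : ℝ} {W : ℝ → H₀ →L[ℝ] Lp ℝ 2 P} {p : ℝ≥0∞}
  {D : U → U →L[ℝ] V} {D2 : U → U →L[ℝ] U →L[ℝ] V} {a b : ℝ≥0}

theorem enorm_adjoint_apply_le (hD : ∀ x, ‖D x‖ ≤ a) (x : U) (y : V) :
    ‖ContinuousLinearMap.adjoint (D x) y‖ₑ ≤ a * ‖y‖ₑ := by
  refine ContinuousLinearMap.le_of_opENorm_le _ ?_ y
  have h : ‖ContinuousLinearMap.adjoint (D x)‖ ≤ a := by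
    rw [LinearIsometryEquiv.norm_map]; exact hD x
  exact_mod_cast h

omit [TopologicalSpace.SeparableSpace H₀] in
/-- The operator `v ↦ (η''(x)(·, S v))* y + η'(x)* R v` has the Hilbert-Schmidt norm of a product
rule. -/
theorem hsNorm_productRule_le (hD : ∀ x, ‖D x‖ ≤ a) (hD2 : ∀ x e, ‖D2 x e‖ ≤ b * ‖e‖)
    (x : U) (y : V) (S : H₀ →L[ℝ] U) (R : H₀ →L[ℝ] V) :
    hsNorm (formOp (D2 x) y ∘L S + ContinuousLinearMap.adjoint (D x) ∘L R) ≤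
      b * (‖y‖ₑ * hsNorm S) + a * hsNorm R := by
  refine (hsNorm_add_le _ _).trans (add_le_add ?_ ?_)
  · rw [← mul_assoc]
    refine hsNorm_le_mul fun v => ?_
    have := norm_formOp_apply_le (hD2 x) y (S v)
    simp only [enorm_eq_nnnorm, ← ENNReal.coe_mul, ENNReal.coe_le_coe]
    exact this
  · exact hsNorm_le_mul fun v => enorm_adjoint_apply_le hD x (R v)

/-- The product rule for finitely many coordinates of `η'(X)* Y` with a damped `Y`: the scalar chain
rule applies to the pair `(X, Y)` in `U × V`. -/
theorem HasMalliavinDeriv.finProj_adjoint_damp (hp1 : 1 ≤ p) (hp : p ≠ ∞)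
    (hD : ∀ x, ‖D x‖ ≤ a)
    (hD2 : ∀ e, HasBddGateauxDeriv (fun x => D x e) (fun x => D2 x e) (b * ‖e‖₊))
    {X : Ω → U} {Y : Ω → V} {ZX : Ω → ℝ → H₀ →L[ℝ] U} {ZY : Ω → ℝ → H₀ →L[ℝ] V}
    (hX : HasMalliavinDeriv P T W p p X ZX) (hY : HasMalliavinDeriv P T W p p Y ZY)
    {ι : Type*} (e : ι → U) (F : Finset ι) {s : ℝ≥0} (hs : 0 < s) :
    HasMalliavinDeriv P T W p p
      (fun ω => finProj e F (ContinuousLinearMap.adjoint (D (X ω)) (damp (s : ℝ) (Y ω))))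
      (fun ω t => finProj e F ∘L (formOp (D2 (X ω)) (damp (s : ℝ) (Y ω)) ∘L ZX ω t +
        ContinuousLinearMap.adjoint (D (X ω)) ∘L dampDeriv (s : ℝ) (Y ω) ∘L ZY ω t)) := by
  let c : U × V →L[ℝ] WithLp 2 (U × V) :=
    (WithLp.prodContinuousLinearEquiv 2 ℝ U V).symm.toContinuousLinearMap
  have hpair := (hX.clm (c ∘L ContinuousLinearMap.inl ℝ U V)).add hp1 hp
    (hY.clm (c ∘L ContinuousLinearMap.inr ℝ U V))
  have hsum := HasMalliavinDeriv.sum hp1 hp F fun i =>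
    (hpair.comp hp1 hp (hasBddGateauxDeriv_inner_damp hD hD2 (e i) hs)).clm
      (ContinuousLinearMap.toSpanSingleton ℝ (e i))
  have hfst : ∀ u v, (c (ContinuousLinearMap.inl ℝ U V u) +
      c (ContinuousLinearMap.inr ℝ U V v)).fst = u := fun u v => add_zero u
  have hsnd : ∀ u v, (c (ContinuousLinearMap.inl ℝ U V u) +
      c (ContinuousLinearMap.inr ℝ U V v)).snd = v := fun u v => zero_add v
  convert hsum using 1
  · ext1 ω
    simp only [finProj_apply, ContinuousLinearMap.comp_apply, hfst, hsnd,
      ContinuousLinearMap.toSpanSingleton_apply, ContinuousLinearMap.adjoint_inner_right]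
  · ext ω t v
    simp only [finProj_apply, ContinuousLinearMap.comp_apply, hfst, hsnd, sum_apply, add_apply,
      ContinuousLinearMap.toSpanSingleton_apply, ContinuousLinearMap.adjoint_inner_right,
      inner_add_right, inner_formOp, innerSL_apply_apply, WithLp.fstL_apply, WithLp.sndL_apply]
    refine Finset.sum_congr rfl fun i _ => ?_
    rw [real_inner_comm]

variable [TopologicalSpace.SeparableSpace U]

/-- The product rule for `η'(X)* Y`. The derivative of `x ↦ η'(x)* y` is only weakly continuous, so
the chain rule is applied to finitely many coordinates of `η'(X)* Y` with a damped `Y`; these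
converge by dominated convergence. -/
theorem HasMalliavinDeriv.adjoint_apply (hp1 : 1 ≤ p) (hp : p ≠ ∞)
    (hD : ∀ x, ‖D x‖ ≤ a)
    (hD2 : ∀ e, HasBddGateauxDeriv (fun x => D x e) (fun x => D2 x e) (b * ‖e‖₊))
    {X : Ω → U} {Y : Ω → V} {ZX : Ω → ℝ → H₀ →L[ℝ] U} {ZY : Ω → ℝ → H₀ →L[ℝ] V}
    (hX : HasMalliavinDeriv P T W p p X ZX) (hY : HasMalliavinDeriv P T W p p Y ZY)
    (hfin : eLpNorm (fun x : Ω × ℝ => ‖Y x.1‖ₑ * hsNorm (ZX x.1 x.2)) p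
      (P.prod (timeMeasure T)) ≠ ∞) :
    HasMalliavinDeriv P T W p p (fun ω => ContinuousLinearMap.adjoint (D (X ω)) (Y ω))
      (fun ω t => formOp (D2 (X ω)) (Y ω) ∘L ZX ω t +
        ContinuousLinearMap.adjoint (D (X ω)) ∘L ZY ω t) := by
  have hp0 : p ≠ 0 := (one_pos.trans_le hp1).ne'
  have hD2' : ∀ x e, ‖D2 x e‖ ≤ b * ‖e‖ := fun x e => by simpa using (hD2 e).norm_le x
  have := countable_onbSet (H := U)
  obtain ⟨F, hF⟩ := exists_seq_tendsto (atTop : Filter (Finset (onbSet U)))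
  let s : ℕ → ℝ≥0 := fun n => ((n : ℝ≥0) + 1)⁻¹
  have hs : ∀ n, 0 < s n := fun n => by positivity
  have hs' : ∀ n, (0 : ℝ) < s n := hs
  have hs0 : Tendsto (fun n => (s n : ℝ)) atTop (𝓝 0) := by
    simpa [s] using tendsto_one_div_add_atTop_nhds_zero_nat (𝕜 := ℝ)
  let XN : ℕ → Ω → U := fun n ω =>
    finProj (onb U) (F n) (ContinuousLinearMap.adjoint (D (X ω)) (damp (s n : ℝ) (Y ω)))
  let Z : Ω → ℝ → H₀ →L[ℝ] U := fun ω t => formOp (D2 (X ω)) (Y ω) ∘L ZX ω t +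
    ContinuousLinearMap.adjoint (D (X ω)) ∘L ZY ω t
  let Q : ℕ → Ω → ℝ → H₀ →L[ℝ] U := fun n ω t =>
    formOp (D2 (X ω)) (damp (s n : ℝ) (Y ω)) ∘L ZX ω t +
    ContinuousLinearMap.adjoint (D (X ω)) ∘L dampDeriv (s n : ℝ) (Y ω) ∘L ZY ω t
  let ZN : ℕ → Ω → ℝ → H₀ →L[ℝ] U := fun n ω t => finProj (onb U) (F n) ∘L Q n ω t
  have hN : ∀ n, HasMalliavinDeriv P T W p p (XN n) (ZN n) := fun n =>
    hX.finProj_adjoint_damp hp1 hp hD hD2 hY (onb U) (F n) (hs n)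
  have hdamp : ∀ y : V, Tendsto (fun n => damp (s n : ℝ) y) atTop (𝓝 y) := fun y =>
    (tendsto_damp y).comp hs0
  have hdampD : ∀ y : V, Tendsto (fun n => dampDeriv (s n : ℝ) y) atTop
      (𝓝 (ContinuousLinearMap.id ℝ V)) := fun y => (tendsto_dampDeriv y).comp hs0
  have hXN : ∀ ω, Tendsto (fun n => XN n ω) atTop
      (𝓝 (ContinuousLinearMap.adjoint (D (X ω)) (Y ω))) := fun ω =>
    tendsto_finProj_apply (onb U) hF
      (((ContinuousLinearMap.adjoint (D (X ω))).continuous.tendsto _).comp (hdamp (Y ω)))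
  -- the difference `Q n - Z` is again of the form of the product rule
  have hQZ : ∀ n ω t, Q n ω t - Z ω t =
      formOp (D2 (X ω)) (damp (s n : ℝ) (Y ω) - Y ω) ∘L ZX ω t +
        ContinuousLinearMap.adjoint (D (X ω)) ∘L
          ((dampDeriv (s n : ℝ) (Y ω) - ContinuousLinearMap.id ℝ V) ∘L ZY ω t) := by
    intro n ω t
    simp only [Q, Z, formOp_sub, ContinuousLinearMap.sub_comp, ContinuousLinearMap.comp_sub,
      ContinuousLinearMap.id_comp]
    abel
  have hfinX := ae_lt_top_of_eLpNorm_ne_top hp0 hp (aemeasurable_hsNorm hX.2.1.1)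
    (by rw [← mixedNorm_eq_eLpNorm_prod hp0 hp hX.2.1.1]; exact hX.2.1.2.ne)
  have hfinY := ae_lt_top_of_eLpNorm_ne_top hp0 hp (aemeasurable_hsNorm hY.2.1.1)
    (by rw [← mixedNorm_eq_eLpNorm_prod hp0 hp hY.2.1.1]; exact hY.2.1.2.ne)
  have hQlim : ∀ ω t, hsNorm (ZX ω t) < ∞ → hsNorm (ZY ω t) < ∞ →
      Tendsto (fun n => hsNorm (Q n ω t - Z ω t)) atTop (𝓝 0) := by
    intro ω t h1 h2
    have l1 : Tendsto (fun n => ‖damp (s n : ℝ) (Y ω) - Y ω‖ₑ) atTop (𝓝 0) := by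
      simpa using ((hdamp (Y ω)).sub_const (Y ω)).enorm
    have l2 : Tendsto (fun n => ‖dampDeriv (s n : ℝ) (Y ω) - ContinuousLinearMap.id ℝ V‖ₑ) atTop
        (𝓝 0) := by
      have h := ((hdampD (Y ω)).sub_const (ContinuousLinearMap.id ℝ V)).enorm
      have h0 : ‖(0 : V →L[ℝ] V)‖ₑ = 0 := by
        rw [← ofReal_norm, norm_zero, ENNReal.ofReal_zero]
      rw [sub_self, h0] at h
      exact h
    have l3 := (ENNReal.Tendsto.const_mul (a := b)
      (ENNReal.Tendsto.mul_const l1 (Or.inr h1.ne)) (Or.inr ENNReal.coe_ne_top)).add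
      (ENNReal.Tendsto.const_mul (a := a)
      (ENNReal.Tendsto.mul_const l2 (Or.inr h2.ne)) (Or.inr ENNReal.coe_ne_top))
    simp only [zero_mul, mul_zero, add_zero] at l3
    refine tendsto_of_tendsto_of_tendsto_of_le_of_le tendsto_const_nhds l3 (fun _ => zero_le)
      fun n => ?_
    simp only [hQZ]
    refine (hsNorm_productRule_le hD hD2' _ _ _ _).trans ?_
    gcongr
    exact hsNorm_comp_le _ _
  have hZle : ∀ ω t, hsNorm (Z ω t) ≤ b * (‖Y ω‖ₑ * hsNorm (ZX ω t)) + a * hsNorm (ZY ω t) :=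
    fun ω t => hsNorm_productRule_le hD hD2' _ _ _ _
  have hQle : ∀ n ω t, hsNorm (Q n ω t) ≤
      b * (‖Y ω‖ₑ * hsNorm (ZX ω t)) + a * (2 * hsNorm (ZY ω t)) := fun n ω t => by
    refine (hsNorm_productRule_le hD hD2' _ _ _ _).trans ?_
    gcongr
    · exact enorm_le_iff_norm_le.2 (norm_damp_le (hs' n) _)
    · refine (hsNorm_comp_le _ _).trans ?_
      gcongr
      have : ‖dampDeriv (s n : ℝ) (Y ω)‖₊ ≤ 2 := norm_dampDeriv_le (hs' n) (Y ω)
      simp only [enorm_eq_nnnorm]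
      exact_mod_cast this
  have hPle : ∀ n, ∀ S : H₀ →L[ℝ] U, hsNorm (finProj (onb U) (F n) ∘L S) ≤ hsNorm S := fun n S => by
    have := hsNorm_le_mul (S := finProj (onb U) (F n) ∘L S) (R := S) (c := 1) fun v => by
      rw [one_mul]
      exact enorm_le_iff_norm_le.2 (norm_finProj_apply_le (onb U).orthonormal _ _)
    rwa [one_mul] at this
  have hZNlim : ∀ᵐ x ∂(P.prod (timeMeasure T)),
      Tendsto (fun n => hsNorm (ZN n x.1 x.2 - Z x.1 x.2)) atTop (𝓝 0) := by
    filter_upwards [hfinX, hfinY] with x h1 h2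
    have hZfin : hsNorm (Z x.1 x.2) ≠ ∞ := by
      refine ((hZle _ _).trans_lt ?_).ne
      exact ENNReal.add_lt_top.2 ⟨ENNReal.mul_lt_top ENNReal.coe_lt_top
        (ENNReal.mul_lt_top enorm_lt_top h1), ENNReal.mul_lt_top ENNReal.coe_lt_top h2⟩
    have l1 : Tendsto (fun n => hsNorm (finProj (onb U) (F n) ∘L Z x.1 x.2 - Z x.1 x.2)) atTop
        (𝓝 0) := by
      refine tendsto_hsNorm_zero (R := Z x.1 x.2) (c := 2) (by norm_num) hZfin (fun n v => ?_)
        fun v => ?_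
      · refine enorm_sub_le.trans ?_
        rw [two_mul]
        refine add_le_add ?_ le_rfl
        exact enorm_le_iff_norm_le.2 (norm_finProj_apply_le (onb U).orthonormal _ _)
      · simpa using ((tendsto_finProj (onb U) (Z x.1 x.2 v)).comp hF).sub_const (Z x.1 x.2 v)
    have l2 := (hQlim _ _ h1 h2).add l1
    rw [add_zero] at l2
    refine tendsto_of_tendsto_of_tendsto_of_le_of_le tendsto_const_nhds l2 (fun _ => zero_le)
      fun n => ?_
    have : ZN n x.1 x.2 - Z x.1 x.2 = finProj (onb U) (F n) ∘L (Q n x.1 x.2 - Z x.1 x.2) +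
        (finProj (onb U) (F n) ∘L Z x.1 x.2 - Z x.1 x.2) := by
      simp only [ZN, ContinuousLinearMap.comp_sub]
      abel
    rw [this]
    exact (hsNorm_add_le _ _).trans (add_le_add_left (hPle n _) _)
  have hZm : OpMeasurable P T Z := fun h => by
    refine aestronglyMeasurable_of_tendsto_ae atTop (f := fun n (x : Ω × ℝ) => ZN n x.1 x.2 h)
      (fun n => (hN n).2.1.1 h) (ae_of_all _ fun x => ?_)
    refine tendsto_finProj_apply (onb U) hF ?_
    have k1 : Tendsto (fun n => formOp (D2 (X x.1)) (damp (s n : ℝ) (Y x.1)) (ZX x.1 x.2 h)) atTop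
        (𝓝 (formOp (D2 (X x.1)) (Y x.1) (ZX x.1 x.2 h))) :=
      ((ContinuousLinearMap.adjoint ((D2 (X x.1)).flip (ZX x.1 x.2 h))).continuous.tendsto
        (Y x.1)).comp (hdamp _)
    have k2 := ((ContinuousLinearMap.adjoint (D (X x.1))).continuous.tendsto _).comp
      (((ContinuousLinearMap.apply ℝ V (ZY x.1 x.2 h)).continuous.tendsto _).comp (hdampD (Y x.1)))
    exact k1.add k2
  have hbound : ∀ c d : ℝ≥0, eLpNorm (fun x : Ω × ℝ =>
      (c : ℝ≥0∞) * (‖Y x.1‖ₑ * hsNorm (ZX x.1 x.2)) +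
      d * hsNorm (ZY x.1 x.2)) p (P.prod (timeMeasure T)) ≠ ∞ := fun c d => by
    have m1 : AEMeasurable (fun x : Ω × ℝ => ‖Y x.1‖ₑ * hsNorm (ZX x.1 x.2))
        (P.prod (timeMeasure T)) :=
      (hY.1.1.comp_fst.enorm).mul (aemeasurable_hsNorm hX.2.1.1)
    have m2 := aemeasurable_hsNorm hY.2.1.1
    refine ((eLpNorm_add_le (m1.const_mul (c : ℝ≥0∞)).aestronglyMeasurable
      (m2.const_mul (d : ℝ≥0∞)).aestronglyMeasurable hp1).trans_lt
      (ENNReal.add_lt_top.2 ⟨?_, ?_⟩)).ne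
    · refine (eLpNorm_le_nnreal_smul_eLpNorm_of_ae_le_mul' (c := c)
        (g := fun x : Ω × ℝ => ‖Y x.1‖ₑ * hsNorm (ZX x.1 x.2))
        (ae_of_all _ fun x => by simp only [enorm_eq_self, le_refl]) p).trans_lt
        (ENNReal.mul_lt_top ENNReal.coe_lt_top ?_)
      exact hfin.lt_top
    · refine (eLpNorm_le_nnreal_smul_eLpNorm_of_ae_le_mul' (c := d)
        (g := fun x : Ω × ℝ => hsNorm (ZY x.1 x.2))
        (ae_of_all _ fun x => by simp only [enorm_eq_self, le_refl]) p).trans_lt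
        (ENNReal.mul_lt_top ENNReal.coe_lt_top ?_)
      rw [← mixedNorm_eq_eLpNorm_prod hp0 hp hY.2.1.1]
      exact hY.2.1.2
  have hYt : MemLp (fun ω => ContinuousLinearMap.adjoint (D (X ω)) (Y ω)) p P := by
    refine MemLp.of_le_mul (c := a) hY.1 (aestronglyMeasurable_of_tendsto_ae atTop
      (fun n => (hN n).1.1) (ae_of_all _ hXN)) (ae_of_all _ fun ω => ?_)
    have := enorm_adjoint_apply_le hD (X ω) (Y ω)
    simp only [enorm_eq_nnnorm, ← ENNReal.coe_mul, ENNReal.coe_le_coe] at this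
    exact this
  refine HasMalliavinDeriv.of_tendsto hp1 hp hN hYt ⟨hZm, ?_⟩ ?_ ?_
  · rw [mixedNorm_eq_eLpNorm_prod hp0 hp hZm]
    exact (eLpNorm_mono_enorm fun x => by simpa only [enorm_eq_self] using hZle x.1 x.2).trans_lt
      (hbound b a).lt_top
  · have hdom : eLpNorm (fun ω => (2 * a : ℝ≥0) * ‖Y ω‖ₑ) p P ≠ ∞ := by
      refine ((eLpNorm_le_nnreal_smul_eLpNorm_of_ae_le_mul' (c := 2 * a) (g := Y)
        (ae_of_all _ fun ω => by simp [enorm_eq_self]) p).trans_lt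
        (ENNReal.mul_lt_top ENNReal.coe_lt_top hY.1.2)).ne
    have := tendsto_eLpNorm_zero hp0 hp (μ := P)
      (f := fun n ω => ‖XN n ω - ContinuousLinearMap.adjoint (D (X ω)) (Y ω)‖ₑ)
      (fun n => ((hN n).1.1.sub hYt.1).enorm) (fun n => ae_of_all _ fun ω => ?_) hdom
      (ae_of_all _ fun ω => ?_)
    · simpa only [eLpNorm_enorm] using this
    · refine enorm_sub_le.trans ?_
      have k1 : ‖XN n ω‖ₑ ≤ a * ‖Y ω‖ₑ := by
        refine (enorm_le_iff_norm_le.2 (norm_finProj_apply_le (onb U).orthonormal _ _)).trans ?_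
        refine (enorm_adjoint_apply_le hD _ _).trans ?_
        gcongr
        exact enorm_le_iff_norm_le.2 (norm_damp_le (hs' n) _)
      refine (add_le_add k1 (enorm_adjoint_apply_le hD _ _)).trans (le_of_eq ?_)
      push_cast
      ring
    · simpa using ((hXN ω).sub_const (ContinuousLinearMap.adjoint (D (X ω)) (Y ω))).enorm
  · refine tendsto_mixedNorm_zero hp0 hp (fun n h => ((hN n).2.1.1 h).sub (hZm h)) (fun n x => ?_)
      (hbound (2 * b) (3 * a)) hZNlim
    refine (hsNorm_sub_le _ _).trans ((add_le_add ((hPle n _).trans (hQle n _ _))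
      (hZle _ _)).trans (le_of_eq ?_))
    push_cast
    ring

end ProductRule

/-! ### Bounds in `𝐆^{1,p}` and its dual -/

section DualEstimate

variable {Ω : Type*} [MeasurableSpace Ω] {P : Measure Ω}
  {H₀ : Type*} [NormedAddCommGroup H₀] [InnerProductSpace ℝ H₀] [CompleteSpace H₀]
  {U V : Type*} [NormedAddCommGroup U] [InnerProductSpace ℝ U]
  [NormedAddCommGroup V] [InnerProductSpace ℝ V]
  {T : ℝ} {W : ℝ → H₀ →L[ℝ] Lp ℝ 2 P} {p q : ℝ≥0∞}

/-- The infimum that defines the norm of `𝐌^{1,p,q}(U)` is the limit of a sequence of values. -/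
theorem MemM.exists_seq_tendsto_mNorm {X : Ω → U} (hX : MemM P T W p q X) :
    ∃ Z : ℕ → Ω → ℝ → H₀ →L[ℝ] U, (∀ n, HasMalliavinDeriv P T W p q X (Z n)) ∧
      Tendsto (fun n => (eLpNorm X p P ^ p.toReal + mixedNorm P T p q (Z n) ^ p.toReal) ^
        (1 / p.toReal)) atTop (𝓝 (mNorm P T W p q X)) := by
  let v : (Ω → ℝ → H₀ →L[ℝ] U) → ℝ≥0∞ := fun Z =>
    (eLpNorm X p P ^ p.toReal + mixedNorm P T p q Z ^ p.toReal) ^ (1 / p.toReal)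
  have hS : mNorm P T W p q X = sInf (v '' {Z | HasMalliavinDeriv P T W p q X Z}) := by
    rw [sInf_image]; rfl
  obtain ⟨u, -, hu, hmem⟩ := exists_seq_tendsto_sInf
    (S := v '' {Z | HasMalliavinDeriv P T W p q X Z})
    (Set.Nonempty.image _ hX) (OrderBot.bddBelow _)
  choose Z hZ hZu using hmem
  refine ⟨Z, hZ, ?_⟩
  rw [hS]
  exact hu.congr fun n => (hZu n).symm

theorem mNorm_ne_top {X : Ω → U} (hX : MemM P T W p q X) :
    mNorm P T W p q X ≠ ∞ := by
  obtain ⟨Z, hZ⟩ := hX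
  refine ((iInf₂_le Z hZ).trans_lt ?_).ne
  refine ENNReal.rpow_lt_top_of_nonneg (by positivity) (ENNReal.add_lt_top.2 ⟨?_, ?_⟩).ne
  · exact ENNReal.rpow_lt_top_of_nonneg (by positivity) hZ.1.2.ne
  · exact ENNReal.rpow_lt_top_of_nonneg (by positivity) hZ.2.1.2.ne

theorem eLpNorm_le_mNorm (hp0 : p ≠ 0) (hp : p ≠ ∞) (X : Ω → U) :
    eLpNorm X p P ≤ mNorm P T W p q X := by
  have hr : 0 < p.toReal := ENNReal.toReal_pos hp0 hp
  refine le_iInf₂ fun Z _ => ?_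
  calc eLpNorm X p P = (eLpNorm X p P ^ p.toReal) ^ (1 / p.toReal) := by
        rw [← ENNReal.rpow_mul, mul_one_div_cancel hr.ne', ENNReal.rpow_one]
    _ ≤ _ := ENNReal.rpow_le_rpow le_self_add (by positivity)

theorem integrable_inner_of_memLp_two {X Y : Ω → U} (hX : MemLp X 2 P) (hY : MemLp Y 2 P) :
    Integrable (fun ω => ⟪X ω, Y ω⟫) P :=
  (hX.norm.integrable_mul hY.norm).mono' (hX.1.inner hY.1)
    (ae_of_all _ fun _ => norm_inner_le_norm _ _)

theorem MemG.gNorm_ne_top {Y : Ω → U} (hY : MemG P T W p Y) :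
    gNorm P T W p Y ≠ ∞ :=
  max_ne_top (mNorm_ne_top hY.1) hY.2.2.ne

theorem ofReal_integral_inner_le {X Y : Ω → U} (hX : MemLp X 2 P) (hY : MemLp Y 2 P) :
    ENNReal.ofReal (∫ ω, ⟪Y ω, X ω⟫ ∂P) ≤ eLpNorm X 2 P * eLpNorm Y 2 P := by
  refine (ENNReal.ofReal_le_ofReal (le_abs_self _)).trans ?_
  rw [← Real.norm_eq_abs, ofReal_norm]
  refine (enorm_integral_le_lintegral_enorm _).trans ?_
  rw [← eLpNorm_one_eq_lintegral_enorm, mul_comm]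
  have := eLpNorm_le_eLpNorm_mul_eLpNorm_of_nnnorm (p := 2) (q := 2) (r := 1) hY.1 hX.1
    (fun y x => ⟪y, x⟫) 1 (ae_of_all _ fun ω => by
      rw [one_mul]; exact norm_inner_le_norm (𝕜 := ℝ) _ _)
  simpa using this

theorem ofReal_integral_inner_le_gDualNorm_mul (hp1 : 1 ≤ p) (hp : p ≠ ∞) {X Y : Ω → U}
    (hY : MemG P T W p Y) :
    ENNReal.ofReal (∫ ω, ⟪Y ω, X ω⟫ ∂P) ≤ gDualNorm P T W p X * gNorm P T W p Y := by
  have hp0 : p ≠ 0 := (one_pos.trans_le hp1).ne'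
  -- if `Y` has norm zero, the quotient in the dual norm carries no information, but then `Y = 0`
  by_cases h0 : gNorm P T W p Y = 0
  · have h1 : eLpNorm Y p P = 0 :=
      le_antisymm (((eLpNorm_le_mNorm hp0 hp Y).trans (le_max_left _ _)).trans h0.le) zero_le
    rw [eLpNorm_eq_zero_iff hY.2.1 hp0] at h1
    have h2 : ∫ ω, ⟪Y ω, X ω⟫ ∂P = 0 := by
      rw [← integral_zero Ω ℝ]
      refine integral_congr_ae ?_
      filter_upwards [h1] with ω hω
      rw [hω, Pi.zero_apply, inner_zero_left]
    simp [h2]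
  · rw [← ENNReal.div_le_iff h0 (hY.gNorm_ne_top)]
    exact le_iSup₂ (f := fun (Y : Ω → U) (_ : MemG P T W p Y) =>
      ENNReal.ofReal (∫ ω, ⟪Y ω, X ω⟫ ∂P) / gNorm P T W p Y) Y hY

/-- Hölder's inequality in `ω` with exponents `2p, 2p`, for the exponent `p` in `t`. -/
theorem eLpNorm_enorm_mul_hsNorm_le [SFinite P] [TopologicalSpace.SeparableSpace H₀]
    {E : Type*} [NormedAddCommGroup E] (hp0 : p ≠ 0) (hp : p ≠ ∞)
    {Y : Ω → E} (hY : AEStronglyMeasurable Y P)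
    {Z : Ω → ℝ → H₀ →L[ℝ] U} (hZ : OpMeasurable P T Z) :
    eLpNorm (fun x : Ω × ℝ => ‖Y x.1‖ₑ * hsNorm (Z x.1 x.2)) p (P.prod (timeMeasure T)) ≤
      eLpNorm Y (2 * p) P * mixedNorm P T (2 * p) p Z := by
  have hr : 0 < p.toReal := ENNReal.toReal_pos hp0 hp
  have h20 : 2 * p ≠ 0 := mul_ne_zero (by norm_num) hp0
  have h2t : 2 * p ≠ ∞ := ENNReal.mul_ne_top (by norm_num) hp
  have h2r : (2 * p).toReal = 2 * p.toReal := by simp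
  simp only [mixedNorm, eLpNorm_eq_lintegral_rpow_enorm_toReal hp0 hp,
    eLpNorm_eq_lintegral_rpow_enorm_toReal h20 h2t, enorm_eq_self, h2r]
  set r := p.toReal with hrdef
  have hm := (aemeasurable_hsNorm hZ).pow_const r
  have hmul : AEMeasurable (fun x : Ω × ℝ => (‖Y x.1‖ₑ * hsNorm (Z x.1 x.2)) ^ r)
      (P.prod (timeMeasure T)) :=
    ((hY.comp_fst.enorm).mul (aemeasurable_hsNorm hZ)).pow_const r
  rw [lintegral_prod _ hmul]
  simp only [ENNReal.mul_rpow_of_nonneg _ _ hr.le]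
  have h1 : ∀ ω, ∫⁻ t, ‖Y ω‖ₑ ^ r * hsNorm (Z ω t) ^ r ∂(timeMeasure T) =
      ‖Y ω‖ₑ ^ r * ∫⁻ t, hsNorm (Z ω t) ^ r ∂(timeMeasure T) := fun ω =>
    lintegral_const_mul' _ _ (ENNReal.rpow_ne_top_of_nonneg hr.le enorm_ne_top)
  simp only [h1]
  have h2 := ENNReal.lintegral_mul_le_Lp_mul_Lq P Real.HolderConjugate.two_two
    (f := fun ω => ‖Y ω‖ₑ ^ r) (g := fun ω => ∫⁻ t, hsNorm (Z ω t) ^ r ∂(timeMeasure T))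
    (hY.enorm.pow_const r) hm.lintegral_prod_right'
  refine (ENNReal.rpow_le_rpow h2 (by positivity)).trans (le_of_eq ?_)
  rw [ENNReal.mul_rpow_of_nonneg _ _ (by positivity), ← ENNReal.rpow_mul, ← ENNReal.rpow_mul]
  have e1 : (1 / 2 : ℝ) * (1 / r) = 1 / (2 * r) := by field_simp
  have e2 : 1 / r * (2 * r) = 2 := by field_simp
  simp only [← ENNReal.rpow_mul, e1, e2, mul_comm r 2]

variable [IsProbabilityMeasure P]

theorem MemG.memLp_two (hp1 : 1 ≤ p) {Y : Ω → U} (hY : MemG P T W p Y) : MemLp Y 2 P :=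
  hY.2.mono_exponent (le_mul_of_one_le_right zero_le hp1)

/-- The dual norm of a square integrable random variable is finite, since the norm of `𝐆^{1,p}`
dominates that of `L²`. -/
theorem gDualNorm_le_eLpNorm_two (hp1 : 1 ≤ p) {X : Ω → U} (hX : MemLp X 2 P) :
    gDualNorm P T W p X ≤ eLpNorm X 2 P := by
  refine iSup₂_le fun Y hY => ENNReal.div_le_of_le_mul ?_
  refine (ofReal_integral_inner_le hX (hY.memLp_two hp1)).trans (mul_le_mul_right ?_ _)
  exact (eLpNorm_le_eLpNorm_of_exponent_le (le_mul_of_one_le_right zero_le hp1) hY.2.1).trans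
    (le_max_right _ _)

variable [CompleteSpace U] [CompleteSpace V] [TopologicalSpace.SeparableSpace H₀]
  [TopologicalSpace.SeparableSpace U]
  {D : U → U →L[ℝ] V} {D2 : U → U →L[ℝ] U →L[ℝ] V} {a b : ℝ≥0}

/-- The map `Y ↦ η'(X)* Y` is bounded on `𝐆^{1,p}`: the bound for a fixed choice of the Malliavin
derivatives. -/
theorem memG_adjoint_apply_and_gNorm_le (hp1 : 1 ≤ p) (hp : p ≠ ∞)
    (hD : ∀ x, ‖D x‖ ≤ a)
    (hD2 : ∀ e, HasBddGateauxDeriv (fun x => D x e) (fun x => D2 x e) (b * ‖e‖₊))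
    {X : Ω → U} {Y : Ω → V} {ZX : Ω → ℝ → H₀ →L[ℝ] U} {ZY : Ω → ℝ → H₀ →L[ℝ] V}
    (hX : HasMalliavinDeriv P T W p p X ZX) (hY : HasMalliavinDeriv P T W p p Y ZY)
    (hY2 : MemLp Y (2 * p) P) {M : ℝ≥0∞} (hM : M ≠ ∞)
    (hle : eLpNorm (fun x : Ω × ℝ => ‖Y x.1‖ₑ * hsNorm (ZX x.1 x.2)) p
      (P.prod (timeMeasure T)) ≤ eLpNorm Y (2 * p) P * M) :
    MemG P T W p (fun ω => ContinuousLinearMap.adjoint (D (X ω)) (Y ω)) ∧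
    gNorm P T W p (fun ω => ContinuousLinearMap.adjoint (D (X ω)) (Y ω)) ≤
      max (a : ℝ≥0∞) b * (1 + M) * max ((eLpNorm Y p P ^ p.toReal +
        mixedNorm P T p p ZY ^ p.toReal) ^ (1 / p.toReal)) (eLpNorm Y (2 * p) P) := by
  have hp0 : p ≠ 0 := (one_pos.trans_le hp1).ne'
  have hr : 0 < p.toReal := ENNReal.toReal_pos hp0 hp
  have hr1 : 1 ≤ p.toReal := by
    have := ENNReal.toReal_mono hp hp1
    simpa using this
  have hfin := (hle.trans_lt (ENNReal.mul_lt_top hY2.2 hM.lt_top)).ne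
  have hZ := hX.adjoint_apply hp1 hp hD hD2 hY hfin
  have hD2' : ∀ x e, ‖D2 x e‖ ≤ b * ‖e‖ := fun x e => by simpa using (hD2 e).norm_le x
  have hbd : ∀ q' : ℝ≥0∞, eLpNorm (fun ω => ContinuousLinearMap.adjoint (D (X ω)) (Y ω)) q' P ≤
      a * eLpNorm Y q' P := fun q' =>
    eLpNorm_le_nnreal_smul_eLpNorm_of_ae_le_mul'
      (ae_of_all _ fun ω => enorm_adjoint_apply_le hD _ _) q'
  have hmem : MemLp (fun ω => ContinuousLinearMap.adjoint (D (X ω)) (Y ω)) (2 * p) P :=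
    ⟨hZ.1.1, (hbd _).trans_lt (ENNReal.mul_lt_top ENNReal.coe_lt_top hY2.2)⟩
  refine ⟨⟨⟨_, hZ⟩, hmem⟩, max_le ?_ ?_⟩
  · have hmix : mixedNorm P T p p (fun ω t => formOp (D2 (X ω)) (Y ω) ∘L ZX ω t +
        ContinuousLinearMap.adjoint (D (X ω)) ∘L ZY ω t) ≤
        a * mixedNorm P T p p ZY + b * (eLpNorm Y (2 * p) P * M) := by
      rw [mixedNorm_eq_eLpNorm_prod hp0 hp hZ.2.1.1, mixedNorm_eq_eLpNorm_prod hp0 hp hY.2.1.1]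
      have m1 : AEMeasurable (fun x : Ω × ℝ => ‖Y x.1‖ₑ * hsNorm (ZX x.1 x.2))
          (P.prod (timeMeasure T)) :=
        (hY.1.1.comp_fst.enorm).mul (aemeasurable_hsNorm hX.2.1.1)
      have m2 := aemeasurable_hsNorm hY.2.1.1
      refine (eLpNorm_mono_enorm (g := (fun x : Ω × ℝ =>
          (b : ℝ≥0∞) * (‖Y x.1‖ₑ * hsNorm (ZX x.1 x.2))) +
        fun x => (a : ℝ≥0∞) * hsNorm (ZY x.1 x.2)) fun x => ?_).trans ?_
      · simpa only [enorm_eq_self, Pi.add_apply] using hsNorm_productRule_le hD hD2' _ _ _ _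
      · refine (eLpNorm_add_le (m1.const_mul (b : ℝ≥0∞)).aestronglyMeasurable
          (m2.const_mul (a : ℝ≥0∞)).aestronglyMeasurable hp1).trans ?_
        rw [add_comm]
        refine add_le_add ?_ (le_trans ?_ (mul_le_mul_right hle _))
        · exact eLpNorm_le_nnreal_smul_eLpNorm_of_ae_le_mul'
            (ae_of_all _ fun x => by simp only [enorm_eq_self, le_refl]) p
        · exact eLpNorm_le_nnreal_smul_eLpNorm_of_ae_le_mul'
            (ae_of_all _ fun x => by simp only [enorm_eq_self, le_refl]) p
    refine (iInf₂_le _ hZ).trans ?_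
    -- Minkowski's inequality in `ℓ^p` for the pairs `(a y, a d)` and `(0, b y2 M)`
    set y := eLpNorm Y p P
    set y2 := eLpNorm Y (2 * p) P
    set d := mixedNorm P T p p ZY
    calc _ ≤ ((a * y + 0) ^ p.toReal + (a * d + b * (y2 * M)) ^ p.toReal) ^ (1 / p.toReal) := by
          gcongr
          rw [add_zero]
          exact hbd p
      _ ≤ ((a * y) ^ p.toReal + (a * d) ^ p.toReal) ^ (1 / p.toReal) +
          ((0 : ℝ≥0∞) ^ p.toReal + (b * (y2 * M)) ^ p.toReal) ^ (1 / p.toReal) := by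
          have := ENNReal.Lp_add_le Finset.univ ![a * y, a * d] ![0, b * (y2 * M)] hr1
          simpa [Fin.sum_univ_two] using this
      _ = a * (y ^ p.toReal + d ^ p.toReal) ^ (1 / p.toReal) + b * (y2 * M) := by
          rw [ENNReal.zero_rpow_of_pos hr, zero_add, ENNReal.mul_rpow_of_nonneg _ _ hr.le,
            ENNReal.mul_rpow_of_nonneg _ _ hr.le, ← mul_add,
            ENNReal.mul_rpow_of_nonneg _ _ (by positivity), ← ENNReal.rpow_mul, ← ENNReal.rpow_mul,
            mul_one_div_cancel hr.ne', ENNReal.rpow_one, ENNReal.rpow_one]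
      _ ≤ max (a : ℝ≥0∞) b * max ((y ^ p.toReal + d ^ p.toReal) ^ (1 / p.toReal)) y2 +
          max (a : ℝ≥0∞) b *
            (max ((y ^ p.toReal + d ^ p.toReal) ^ (1 / p.toReal)) y2 * M) := by
          gcongr
          · exact le_max_left _ _
          · exact le_max_left _ _
          · exact le_max_right _ _
          · exact le_max_right _ _
      _ = _ := by ring
  · refine (hbd _).trans (mul_le_mul' ?_ (le_max_right _ _))
    exact (le_max_left _ _).trans (le_mul_of_one_le_right zero_le le_self_add)

/-- The map `Y ↦ η'(ρX₁ + (1-ρ)X₂)* Y` is bounded on `𝐆^{1,p}`, uniformly in `ρ ∈ [0,1]`. -/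
theorem MemG.adjoint_apply_convexComb (hp1 : 1 ≤ p) (hp : p ≠ ∞)
    (hD : ∀ x, ‖D x‖ ≤ a)
    (hD2 : ∀ e, HasBddGateauxDeriv (fun x => D x e) (fun x => D2 x e) (b * ‖e‖₊))
    {X₁ X₂ : Ω → U} (hX₁ : MemM P T W (2 * p) p X₁) (hX₂ : MemM P T W (2 * p) p X₂)
    {Y : Ω → V} (hY : MemG P T W p Y) {ρ : ℝ} (hρ0 : 0 ≤ ρ) (hρ1 : ρ ≤ 1) :
    MemG P T W p
      (fun ω => ContinuousLinearMap.adjoint (D (ρ • X₁ ω + (1 - ρ) • X₂ ω)) (Y ω)) ∧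
    gNorm P T W p
      (fun ω => ContinuousLinearMap.adjoint (D (ρ • X₁ ω + (1 - ρ) • X₂ ω)) (Y ω)) ≤
      max (a : ℝ≥0∞) b * (1 + (mNorm P T W (2 * p) p X₁ + mNorm P T W (2 * p) p X₂)) *
        gNorm P T W p Y := by
  have hp0 : p ≠ 0 := (one_pos.trans_le hp1).ne'
  have h20 : 2 * p ≠ 0 := mul_ne_zero (by norm_num) hp0
  have h2t : 2 * p ≠ ∞ := ENNReal.mul_ne_top (by norm_num) hp
  have h2r : 0 < (2 * p).toReal := ENNReal.toReal_pos h20 h2t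
  have hpp : p ≤ 2 * p := le_mul_of_one_le_left zero_le one_le_two
  have hmixle : ∀ {X : Ω → U} (Z : Ω → ℝ → H₀ →L[ℝ] U), mixedNorm P T (2 * p) p Z ≤
      (eLpNorm X (2 * p) P ^ (2 * p).toReal + mixedNorm P T (2 * p) p Z ^ (2 * p).toReal) ^
        (1 / (2 * p).toReal) := fun {X} Z => by
    calc mixedNorm P T (2 * p) p Z =
          (mixedNorm P T (2 * p) p Z ^ (2 * p).toReal) ^ (1 / (2 * p).toReal) := by
          rw [← ENNReal.rpow_mul, mul_one_div_cancel h2r.ne', ENNReal.rpow_one]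
      _ ≤ _ := ENNReal.rpow_le_rpow le_add_self (by positivity)
  obtain ⟨Z₁, hZ₁, hv₁⟩ := hX₁.exists_seq_tendsto_mNorm
  obtain ⟨Z₂, hZ₂, hv₂⟩ := hX₂.exists_seq_tendsto_mNorm
  obtain ⟨ZY, hZY, hvY⟩ := hY.1.exists_seq_tendsto_mNorm
  -- the random variable does not depend on the choice of the derivatives, so that the bound for
  -- each choice passes to the infimum
  have key : ∀ n, _ := fun n => by
    have hX := ((((hZ₁ n).mono_exponent hpp hp0 hp).clm (ρ • ContinuousLinearMap.id ℝ U)).add hp1 hp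
      (((hZ₂ n).mono_exponent hpp hp0 hp).clm ((1 - ρ) • ContinuousLinearMap.id ℝ U)))
    refine memG_adjoint_apply_and_gNorm_le hp1 hp hD hD2 hX (hZY n) hY.2
      (M := mixedNorm P T (2 * p) p (Z₁ n) + mixedNorm P T (2 * p) p (Z₂ n))
      (ENNReal.add_ne_top.2 ⟨(hZ₁ n).2.1.2.ne, (hZ₂ n).2.1.2.ne⟩) ?_
    rw [mul_add]
    refine le_trans ?_ (add_le_add
      (eLpNorm_enorm_mul_hsNorm_le hp0 hp hY.2.1 (hZ₁ n).2.1.1)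
      (eLpNorm_enorm_mul_hsNorm_le hp0 hp hY.2.1 (hZ₂ n).2.1.1))
    refine le_trans (eLpNorm_mono_enorm fun x => ?_) (eLpNorm_add_le
      ((hY.2.1.comp_fst.enorm).mul (aemeasurable_hsNorm (hZ₁ n).2.1.1)).aestronglyMeasurable
      ((hY.2.1.comp_fst.enorm).mul (aemeasurable_hsNorm (hZ₂ n).2.1.1)).aestronglyMeasurable hp1)
    simp only [Pi.add_apply, enorm_eq_self, ← mul_add]
    gcongr
    have hc : ∀ (c : ℝ) (S : H₀ →L[ℝ] U), 0 ≤ c → c ≤ 1 →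
        hsNorm ((c • ContinuousLinearMap.id ℝ U) ∘L S) ≤ hsNorm S := fun c S h0 h1 => by
      have := hsNorm_le_mul (S := (c • ContinuousLinearMap.id ℝ U) ∘L S) (R := S) (c := 1)
        fun v => by
          rw [one_mul, enorm_le_iff_norm_le]
          change ‖c • S v‖ ≤ _
          rw [norm_smul, Real.norm_of_nonneg h0]
          exact mul_le_of_le_one_left (norm_nonneg _) h1
      rwa [one_mul] at this
    exact (hsNorm_add_le _ _).trans (add_le_add (hc ρ _ hρ0 hρ1)
      (hc (1 - ρ) _ (by linarith) (by linarith)))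
  refine ⟨(key 0).1, ?_⟩
  have hfin₁ := mNorm_ne_top hX₁
  have hfin₂ := mNorm_ne_top hX₂
  have hlim := ENNReal.Tendsto.mul
    (ENNReal.Tendsto.const_mul (a := max (a : ℝ≥0∞) b) ((hv₁.add hv₂).const_add 1)
      (Or.inr (max_ne_top ENNReal.coe_ne_top ENNReal.coe_ne_top)))
    (Or.inr (hY.gNorm_ne_top))
    (hvY.max (tendsto_const_nhds (x := eLpNorm Y (2 * p) P)))
    (Or.inr (ENNReal.mul_ne_top (max_ne_top ENNReal.coe_ne_top ENNReal.coe_ne_top)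
      (ENNReal.add_ne_top.2 ⟨ENNReal.one_ne_top, ENNReal.add_ne_top.2 ⟨hfin₁, hfin₂⟩⟩)))
  refine ge_of_tendsto' hlim fun n => ((key n).2).trans ?_
  gcongr
  · exact hmixle (Z₁ n)
  · exact hmixle (Z₂ n)

end DualEstimate

/-! ### Differentiation along segments -/

section MeanValue

variable {Ω : Type*} [MeasurableSpace Ω] {P : Measure Ω}
  {U V : Type*} [NormedAddCommGroup U] [NormedSpace ℝ U]
  [NormedAddCommGroup V] [InnerProductSpace ℝ V]

/-- Differentiation under the expectation along a segment. -/
theorem hasDerivAt_integral_inner_comp_line {η : U → V} {D : U → U →L[ℝ] V} {a : ℝ≥0}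
    (hη : HasBddGateauxDeriv η D a) {X K : Ω → U} {Y : Ω → V} (hX : AEStronglyMeasurable X P)
    (hK : MemLp K 2 P) (hY : MemLp Y 2 P) (hηX : ∀ ρ : ℝ, MemLp (fun ω => η (X ω + ρ • K ω)) 2 P)
    (ρ : ℝ) :
    HasDerivAt (fun ρ : ℝ => ∫ ω, ⟪Y ω, η (X ω + ρ • K ω)⟫ ∂P)
      (∫ ω, ⟪Y ω, D (X ω + ρ • K ω) (K ω)⟫ ∂P) ρ := by
  refine (hasDerivAt_integral_of_dominated_loc_of_deriv_le (F := fun (ρ : ℝ) ω =>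
    ⟪Y ω, η (X ω + ρ • K ω)⟫) (F' := fun (ρ : ℝ) ω => ⟪Y ω, D (X ω + ρ • K ω) (K ω)⟫)
    (bound := fun ω => a * (‖Y ω‖ * ‖K ω‖)) Filter.univ_mem
    (Eventually.of_forall fun ρ => hY.1.inner (hηX ρ).1)
    (integrable_inner_of_memLp_two hY (hηX ρ)) (hY.1.inner ?_) (ae_of_all _ fun ω ρ _ => ?_) ?_
    (ae_of_all _ fun ω ρ _ => ?_)).2
  · exact hη.continuous_uncurry.comp_aestronglyMeasurable
      ((hX.add (hK.1.const_smul ρ)).prodMk hK.1)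
  · calc _ ≤ ‖Y ω‖ * ‖D (X ω + ρ • K ω) (K ω)‖ := norm_inner_le_norm _ _
      _ ≤ ‖Y ω‖ * (a * ‖K ω‖) := by
          gcongr
          exact (D _).le_of_opNorm_le (hη.norm_le _) _
      _ = _ := by ring
  · exact (hY.norm.integrable_mul hK.norm).const_mul _
  · have h := (hasDerivAt_const ρ (Y ω)).inner ℝ
      (hasDerivAt_line (hη.hasLineDerivAt (X ω + ρ • K ω) (K ω)))
    simpa using h

end MeanValue

end SobolevMalliavin

open SobolevMalliavin in
theorem lemma3
    {Ω : Type*} [MeasurableSpace Ω] (P : Measure Ω) [IsProbabilityMeasure P]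
    {H₀ : Type*} [NormedAddCommGroup H₀] [InnerProductSpace ℝ H₀] [CompleteSpace H₀]
    [TopologicalSpace.SeparableSpace H₀]
    {U : Type*} [NormedAddCommGroup U] [InnerProductSpace ℝ U] [CompleteSpace U]
    [TopologicalSpace.SeparableSpace U]
    {V : Type*} [NormedAddCommGroup V] [InnerProductSpace ℝ V] [CompleteSpace V]
    [TopologicalSpace.SeparableSpace V]
    (T : ℝ) (hT : 0 < T) (W : ℝ → H₀ →L[ℝ] Lp ℝ 2 P)
    (hW : SobolevMalliavin.IsCylindricalWiener P T W)
    (η : U → V) (hη : SobolevMalliavin.IsGb 2 η)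
    (p : ℝ≥0∞) (hp : 2 < p) (hp_top : p < ∞)
    (X₁ X₂ : Ω → U)
    (hX₁ : SobolevMalliavin.MemM P T W (2 * p) p X₁)
    (hX₂ : SobolevMalliavin.MemM P T W (2 * p) p X₂) :
    MemLp (fun ω => η (X₁ ω)) 2 P ∧ MemLp (fun ω => η (X₂ ω)) 2 P ∧
    SobolevMalliavin.gDualNorm P T W p (fun ω => η (X₁ ω) - η (X₂ ω)) ≤
      max (SobolevMalliavin.gSeminorm 1 η) (SobolevMalliavin.gSeminorm 2 η) *
        (1 + (SobolevMalliavin.mNorm P T W (2 * p) p X₁ +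
          SobolevMalliavin.mNorm P T W (2 * p) p X₂)) *
        SobolevMalliavin.gDualNorm P T W p (fun ω => X₁ ω - X₂ ω) := by
  have hp1 : 1 ≤ p := one_le_two.trans hp.le
  have ha := hη.2 1 le_rfl (by norm_num)
  have hb := hη.2 2 (by norm_num) le_rfl
  obtain ⟨D, D2, hD, hD2⟩ := hη.exists_hasBddGateauxDeriv
  have h2p : 2 ≤ 2 * p := le_mul_of_one_le_right zero_le hp1
  have hX₁2 : MemLp X₁ 2 P := by
    obtain ⟨Z, hZ⟩ := hX₁
    exact hZ.1.mono_exponent h2p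
  have hX₂2 : MemLp X₂ 2 P := by
    obtain ⟨Z, hZ⟩ := hX₂
    exact hZ.1.mono_exponent h2p
  have hK : MemLp (fun ω => X₁ ω - X₂ ω) 2 P := hX₁2.sub hX₂2
  have hη₁ := memLp_comp_lipschitzWith hD.lipschitzWith hX₁2
  have hη₂ := memLp_comp_lipschitzWith hD.lipschitzWith hX₂2
  refine ⟨hη₁, hη₂, iSup₂_le fun Y hY => ENNReal.div_le_of_le_mul ?_⟩
  have hY2 := hY.memLp_two hp1
  set C := max (gSeminorm 1 η) (gSeminorm 2 η) *
    (1 + (mNorm P T W (2 * p) p X₁ + mNorm P T W (2 * p) p X₂)) with hC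
  set δ := gDualNorm P T W p (fun ω => X₁ ω - X₂ ω)
  have hfin : C * δ * gNorm P T W p Y ≠ ∞ := by
    refine ENNReal.mul_ne_top (ENNReal.mul_ne_top (ENNReal.mul_ne_top
      (max_ne_top ha.ne hb.ne) ?_) ?_) hY.gNorm_ne_top
    · exact ENNReal.add_ne_top.2 ⟨ENNReal.one_ne_top, ENNReal.add_ne_top.2
        ⟨mNorm_ne_top hX₁, mNorm_ne_top hX₂⟩⟩
    · exact ((gDualNorm_le_eLpNorm_two hp1 hK).trans_lt hK.2).ne
  have hderiv := hasDerivAt_integral_inner_comp_line hD hX₂2.1 hK hY2 fun ρ =>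
    memLp_comp_lipschitzWith hD.lipschitzWith (hX₂2.add (hK.const_smul ρ))
  -- the derivative is the pairing of `X₁ - X₂` with the test variable `η'(ρX₁ + (1-ρ)X₂)* Y`
  have hle : ∀ ρ ∈ interior (Set.Icc (0 : ℝ) 1),
      deriv (fun ρ : ℝ => ∫ ω, ⟪Y ω, η (X₂ ω + ρ • (X₁ ω - X₂ ω))⟫ ∂P) ρ ≤
        (C * δ * gNorm P T W p Y).toReal := fun ρ hρ => by
    rw [interior_Icc] at hρ
    obtain ⟨hG, hGle⟩ := hY.adjoint_apply_convexComb hp1 hp_top.ne hD.norm_le hD2 hX₁ hX₂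
      hρ.1.le hρ.2.le
    rw [ENNReal.coe_toNNReal ha.ne, ENNReal.coe_toNNReal hb.ne, ← hC] at hGle
    have hdual := ofReal_integral_inner_le_gDualNorm_mul hp1 hp_top.ne
      (X := fun ω => X₁ ω - X₂ ω) hG
    have heq : ∫ ω, ⟪Y ω, D (X₂ ω + ρ • (X₁ ω - X₂ ω)) (X₁ ω - X₂ ω)⟫ ∂P =
        ∫ ω, ⟪ContinuousLinearMap.adjoint (D (ρ • X₁ ω + (1 - ρ) • X₂ ω)) (Y ω),
          X₁ ω - X₂ ω⟫ ∂P := by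
      congr 1
      ext ω
      rw [ContinuousLinearMap.adjoint_inner_left]
      congr 3
      module
    rw [(hderiv ρ).deriv, heq]
    refine (ENNReal.ofReal_le_iff_le_toReal hfin).1 ?_
    calc _ ≤ δ * (C * gNorm P T W p Y) := hdual.trans (mul_le_mul_right hGle δ)
      _ = _ := by ring
  have hmv := (convex_Icc (0 : ℝ) 1).image_sub_le_mul_sub_of_deriv_le
    (fun ρ _ => (hderiv ρ).continuousAt.continuousWithinAt)
    (fun ρ _ => (hderiv ρ).differentiableAt.differentiableWithinAt) hle
    0 (by simp) 1 (by simp) zero_le_one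
  simp only [one_smul, zero_smul, add_zero, add_sub_cancel, sub_zero, mul_one] at hmv
  rw [← integral_sub (integrable_inner_of_memLp_two hY2 hη₁)
    (integrable_inner_of_memLp_two hY2 hη₂)] at hmv
  simp only [← inner_sub_right] at hmv
  exact ENNReal.ofReal_le_of_le_toReal hmv
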